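/- Let $\lambda>0$, $K>0$, $\beta>2$, and let $(S,P,T)$ be a random vector with almost surely positive (possibly dependent) coordinates such that $\mathbf E[(PS)^{2/\beta}]<\infty$. Let $\Phi=\{X\}$ be a homogeneous Poisson process on $\mathbb R^2$ with density $\lambda$ and, given $\Phi$, let the marks $(S_X,P_X,T_X)_{X\in\Phi}$ (propagation effect, power, SINR threshold) be independent across $X$ and distributed as $(S,P,T)$; we call this a network with density $\lambda$ and marks $(S,P,T)$. Put $Y_X=(K|X|)^\beta/(P_XS_X)$. The marked propagation process of the network is $\widetilde\Theta=\{(Y_X,T_X):X\in\Phi\}$, and two networks are called stochastically equivalent if their marked propagation processes have the same distribution. For constants $W\ge 0$ and $\gamma\in[0,1]$ put $I=\sum_{X\in\Phi}Y_X^{-1}$ and $$\mathrm{SINR}(X)=\frac{Y_X^{-1}}{W+\gamma(I-Y_X^{-1})},\qquad \mathrm{STINR}(X)=\frac{Y_X^{-1}}{W+\gamma I},$$ with values in $[0,\infty]$ (both are $\infty$ if $W=\gamma=0$). (1) (Marked propagation invariance.) $\widetilde\Theta$ is an independently marked inhomogeneous Poisson process on $\mathbb R_+$; its intensity measure is given,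 for $s\ge 0$ and $t\in\mathbb R$, by $$\Lambda(s,t):=\mathbf E\Big[\sum_{(Y,T)\in\widetilde\Theta}\mathbf 1(Y\le s,\,T\le t)\Big]=\frac{\lambda\pi s^{2/\beta}}{K^2}\,\mathbf E\big[(PS)^{2/\beta}\mathbf 1(T\le t)\big].$$ That is, $\widetilde\Theta$, as a point process of pairs, is a Poisson process with intensity measure $\Lambda$; and, given the Poisson process $\{Y\}$ of its points, its marks are independent and identically distributed, with the distribution function $F_{T^*}$ of (2). (2) (Equivalent network.) The function $$F_{T^*}(t)=\frac{\mathbf E[(PS)^{2/\beta}\mathbf 1(T\le t)]}{\mathbf E[(PS)^{2/\beta}]}$$ is the distribution function of a probability measure. Let $\lambda^*=\lambda\,\mathbf E[(PS)^{2/\beta}]=aK^2/\pi$, where $a=\lambda\pi\mathbf E[(PS)^{2/\beta}]/K^2$. There exists a network with density $\lambda^*$ and marks $(1,1,T^*)$, where $T^*$ has distribution function $F_{T^*}$ (and with the same $K$, $\beta$), that is stochastically equivalent to the given one; in fact every such network is. Moreover, for every such network and all $W\ge0$, $\gamma\in[0,1]$, the marked SINR process $\{(\mathrm{SINR}(X),T_X)\}$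 of the given network has the same distribution as that of the network with marks $(1,1,T^*)$, and the factorial moment measures of all orders of the processes $\{\mathrm{SINR}(X)\}$ of the two networks coincide. The same two assertions hold with $\mathrm{STINR}$ in place of $\mathrm{SINR}$. -/

import Mathlib

open MeasureTheory ProbabilityTheory Set
open scoped ENNReal NNReal

universe u v w

noncomputable section

namespace SINRNetwork

section PointProcesses

variable {Ω : Type*} [MeasurableSpace Ω] {E : Type*} [MeasurableSpace E]
  {M : Type*} [MeasurableSpace M]

/-- The point process `{x 0, x 1, …}`, as the random counting measure `∑ₙ δ_{x n}`. -/
def countingProcess (x : ℕ → Ω → E) : Ω → Measure E :=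
  fun ω => Measure.sum fun n => Measure.dirac (x n ω)

/-- `N` is a Poisson process with intensity measure `Λ`: the number of points in a set `B` is
Poisson distributed with mean `Λ B` (and almost surely infinite if `Λ B = ∞`), and the numbers of
points in disjoint sets are independent. -/
structure IsPoissonProcess (N : Ω → Measure E) (Λ : Measure E) (μ : Measure Ω) : Prop where
  measurable : Measurable N
  law_of_finite : ∀ B : Set E, MeasurableSet B → Λ B ≠ ∞ →
    μ.map (fun ω => N ω B) =
      (poissonMeasure (Λ B).toNNReal).map (fun k : ℕ => (k : ℝ≥0∞))
  eq_top_of_infinite : ∀ B : Set E, MeasurableSet B → Λ B = ∞ → ∀ᵐ ω ∂μ, N ω B = ∞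
  indep : ∀ (n : ℕ) (B : Fin n → Set E), (∀ i, MeasurableSet (B i)) →
    Pairwise (fun i j => Disjoint (B i) (B j)) → iIndepFun (fun i ω => N ω (B i)) μ

/-- The `m n` are independent marks of the points `x n`, with common distribution `Q`: given
the points, the marks are independent and distributed according to `Q`. -/
structure IsIndependentMarking (x : ℕ → Ω → E) (m : ℕ → Ω → M) (Q : Measure M)
    (μ : Measure Ω) : Prop where
  measurable_point : ∀ n, Measurable (x n)
  measurable_mark : ∀ n, Measurable (m n)
  law_mark : ∀ n, μ.map (m n) = Q
  indep_marks : iIndepFun m μ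
  indep_points_marks : IndepFun (fun ω n => x n ω) (fun ω n => m n ω) μ

/-- `N`, a point process of pairs (point, mark) with infinitely many points, is an independently
marked Poisson process on `E` with intensity measure `Λ` and mark distribution `Q`: its points form
a Poisson process on `E`, its marks are independent marks of these points with distribution `Q`,
and the mean number of pairs in `B` is `Λ B`. -/
structure IsIndependentlyMarkedPoisson (N : Ω → Measure (E × M)) (Λ : Measure (E × M))
    (Q : Measure M) (μ : Measure Ω) : Prop where
  ground : IsPoissonProcess (fun ω => (N ω).map Prod.fst) (Λ.map Prod.fst) μ
  marking : ∃ (x : ℕ → Ω → E) (m : ℕ → Ω → M), IsIndependentMarking x m Q μ ∧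
    ∀ᵐ ω ∂μ, N ω = countingProcess (fun n ω => (x n ω, m n ω)) ω
  intensity : ∀ B : Set (E × M), MeasurableSet B → ∫⁻ ω, N ω B ∂μ = Λ B

/-- The `n`-th factorial moment measure of the point process `{z 0, z 1, …}`,
`B ↦ 𝐄 #{(i₁, …, iₙ) distinct : (z i₁, …, z iₙ) ∈ B}`
(see `factorialMomentMeasure_apply`). -/
def factorialMomentMeasure (z : ℕ → Ω → E) (n : ℕ) (μ : Measure Ω) : Measure (Fin n → E) :=
  Measure.sum fun i : Fin n ↪ ℕ => μ.map (fun ω j => z (i j) ω)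

theorem factorialMomentMeasure_apply (z : ℕ → Ω → E) (hz : ∀ k, Measurable (z k)) (n : ℕ)
    (μ : Measure Ω) (B : Set (Fin n → E)) (hB : MeasurableSet B) :
    factorialMomentMeasure z n μ B =
      ∫⁻ ω, ∑' i : Fin n ↪ ℕ, B.indicator (fun _ => (1 : ℝ≥0∞)) (fun j => z (i j) ω) ∂μ := by
  have hm : ∀ i : Fin n ↪ ℕ, Measurable (fun ω (j : Fin n) => z (i j) ω) :=
    fun i => measurable_pi_lambda _ fun j => hz (i j)
  have hc : Countable (Fin n ↪ ℕ) := DFunLike.coe_injective.countable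
  have hi : Measurable (B.indicator fun _ => (1 : ℝ≥0∞)) := measurable_const.indicator hB
  rw [lintegral_tsum (f := fun (i : Fin n ↪ ℕ) ω =>
    B.indicator (fun _ => (1 : ℝ≥0∞)) (fun j => z (i j) ω)) fun i =>
      (hi.comp (hm i)).aemeasurable]
  simp only [factorialMomentMeasure, Measure.sum_apply _ hB]
  refine tsum_congr fun i => ?_
  rw [← lintegral_map (f := B.indicator fun _ => (1 : ℝ≥0∞)) hi (hm i),
    lintegral_indicator_const hB, one_mul]

end PointProcesses

section Network

variable {Ω : Type*} [MeasurableSpace Ω]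

/-- The plane `ℝ²` with the Euclidean norm. -/
abbrev Plane : Type := EuclideanSpace ℝ (Fin 2)

/-- Path-loss function `ℓ(r) = (K r) ^ β`. -/
def pathLoss (K β r : ℝ) : ℝ := (K * r) ^ β

/-- A heterogeneous network with varying thresholds: the base stations `X n` form a homogeneous
Poisson process of density `lam` on the plane, and the vectors `(S n, P n, T n)` (propagation
effect, power, threshold) are independent marks of the base stations, with distribution `Q`. -/
structure IsNetwork (lam : ℝ) (X : ℕ → Ω → Plane) (S P T : ℕ → Ω → ℝ)
    (Q : Measure (ℝ × ℝ × ℝ)) (μ : Measure Ω) : Prop where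
  poisson : IsPoissonProcess (countingProcess X) (ENNReal.ofReal lam • volume) μ
  marks : IsIndependentMarking X (fun n ω => (S n ω, P n ω, T n ω)) Q μ

/-- Propagation loss `Y n = ℓ(|X n|) / (P n S n)` of the `n`-th base station. -/
def loss (K β : ℝ) (X : ℕ → Ω → Plane) (S P : ℕ → Ω → ℝ) (n : ℕ) (ω : Ω) : ℝ :=
  pathLoss K β ‖X n ω‖ / (P n ω * S n ω)

/-- The marked propagation process `{(Y, T)}`. -/
def markedPropagation (K β : ℝ) (X : ℕ → Ω → Plane) (S P T : ℕ → Ω → ℝ) :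
    Ω → Measure (ℝ × ℝ) :=
  countingProcess fun n ω => (loss K β X S P n ω, T n ω)

/-- Received power `Y⁻¹` from the `n`-th base station, in `[0, ∞]`. -/
def power (K β : ℝ) (X : ℕ → Ω → Plane) (S P : ℕ → Ω → ℝ) (n : ℕ) (ω : Ω) : ℝ≥0∞ :=
  (ENNReal.ofReal (loss K β X S P n ω))⁻¹

/-- Power `I = ∑ Y⁻¹` received from the whole network. -/
def totalPower (K β : ℝ) (X : ℕ → Ω → Plane) (S P : ℕ → Ω → ℝ) (ω : Ω) : ℝ≥0∞ :=
  ∑' n, power K β X S P n ω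

/-- `SINR(X) = Y⁻¹ / (W + γ (I - Y⁻¹))`, computed in `[0, ∞]`. -/
def sinr (W γ : ℝ≥0) (K β : ℝ) (X : ℕ → Ω → Plane) (S P : ℕ → Ω → ℝ) (n : ℕ) (ω : Ω) : ℝ≥0∞ :=
  power K β X S P n ω / (W + γ * (totalPower K β X S P ω - power K β X S P n ω))

/-- `STINR(X) = Y⁻¹ / (W + γ I)`, computed in `[0, ∞]`. -/
def stinr (W γ : ℝ≥0) (K β : ℝ) (X : ℕ → Ω → Plane) (S P : ℕ → Ω → ℝ) (n : ℕ) (ω : Ω) : ℝ≥0∞ :=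
  power K β X S P n ω / (W + γ * totalPower K β X S P ω)

/-- Point processes on `E` over two probability spaces that are equal in distribution;
two networks are stochastically equivalent if their marked propagation processes are. -/
def EqualInLaw {Ω' : Type*} [MeasurableSpace Ω'] {E : Type*} [MeasurableSpace E]
    (N : Ω → Measure E) (μ : Measure Ω) (N' : Ω' → Measure E) (μ' : Measure Ω') : Prop :=
  IdentDistrib N N' μ μ'

/-- `𝐄[(P S)^{2/β}]`. -/
def propMoment (β : ℝ) (S P : Ω → ℝ) (μ : Measure Ω) : ℝ :=
  ∫ ω, (P ω * S ω) ^ (2 / β) ∂μ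

/-- `𝐄[(P S)^{2/β} 𝟏(T ≤ t)]`. -/
def propMomentUpTo (β : ℝ) (S P T : Ω → ℝ) (t : ℝ) (μ : Measure Ω) : ℝ :=
  ∫ ω, (P ω * S ω) ^ (2 / β) * {ω | T ω ≤ t}.indicator (fun _ => (1 : ℝ)) ω ∂μ

/-- The propagation constant `a = λ π 𝐄[(P S)^{2/β}] / K²`. -/
def propConstant (lam K β : ℝ) (S P : Ω → ℝ) (μ : Measure Ω) : ℝ :=
  lam * Real.pi * propMoment β S P μ / K ^ 2

end Network

end SINRNetwork

end

open SINRNetwork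

open Filter Topology

/-! The mark of a station can be absorbed into its position. Path loss is homogeneous of degree `β`,
so the loss `(K|x|)^β / (PS)` is the path loss at the rescaled point `(PS)^(-1/β) x`
(`pathLoss_norm_smul`). By the marking theorem (`isPoisson_marked`) the stations with their marks
form a Poisson process with intensity `λ dx ⊗ Q`. In the plane the rescaling multiplies area by
`(PS)^(-2/β)`, hence density by `(PS)^(2/β)`. The rescaled points with their thresholds therefore
form a Poisson process with intensity `λ dx ⊗ 𝐄[(PS)^(2/β) 𝟏(T ∈ ·)] = λ* dx ⊗ F`, again a product
(`map_smul_prod`). This is the intensity of a homogeneous network with unit propagation effect and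
power and with thresholds of law `F`. A Poisson process is determined in law by its intensity
(`IsPoissonProcess.identDistrib`), so any such network has the same marked propagation process.

The Poisson facts rest on Laplace functionals. Being Poisson is equivalent, for a measurable random
measure, to having the Poisson Laplace functional (`hasPoissonLaplace`,
`HasPoissonLaplace.isPoissonProcess`), and this functional determines the law
(`identDistrib_of_laplace`).

The other difficulty is enumeration. The points come as sequences whose indexing has no meaning for
the process, while SINR values, factorial moments and independent marks are read off sequences.
Almost surely the losses are distinct and locally finite (`ae_orderable_of_lossIntensity`), so they
can be sorted. The counts in a countable basis determine the sorted sequence, and Lusin-Souslin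
turns this into equality of laws (`identDistrib_sortSeq`). Functionals that ignore the indexing then
transfer from one network to the other (`identDistrib_of_perm_invariant`), and the sorted marks are
seen to be i.i.d. and independent of the points (`exists_isIndependentMarking`). -/

/-! ### The exponential on `[0, ∞]` and the Laplace transform of the Poisson law. -/

/-- `x ↦ e ^ (-x)` on `[0, ∞]`. -/
noncomputable def expNeg (x : ℝ≥0∞) : ℝ≥0∞ := (EReal.exp x)⁻¹

theorem expNeg_zero : expNeg 0 = 1 := by simp [expNeg]

theorem expNeg_top : expNeg ∞ = 0 := by simp [expNeg]

theorem expNeg_coe (r : ℝ≥0) : expNeg r = ENNReal.ofReal (Real.exp (-r)) := by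
  have : ((r : ℝ≥0∞) : EReal) = ((r : ℝ) : EReal) := rfl
  rw [expNeg, this, EReal.exp_coe, Real.exp_neg, ENNReal.ofReal_inv_of_pos (Real.exp_pos _)]

theorem expNeg_add (x y : ℝ≥0∞) : expNeg (x + y) = expNeg x * expNeg y := by
  have h : ∀ x : ℝ≥0∞, EReal.exp x ≠ 0 := fun x => by simp
  rw [expNeg, EReal.coe_ennreal_add, EReal.exp_add, ENNReal.mul_inv (.inl (h x)) (.inr (h y))]
  rfl

theorem continuous_expNeg : Continuous expNeg :=
  continuous_inv.comp (ENNReal.continuous_exp.comp continuous_coe_ennreal_ereal)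

theorem measurable_expNeg : Measurable expNeg := continuous_expNeg.measurable

theorem Measurable.expNeg {α : Type*} [MeasurableSpace α] {f : α → ℝ≥0∞} (hf : Measurable f) :
    Measurable fun x => _root_.expNeg (f x) :=
  measurable_expNeg.comp hf

theorem expNeg_injective : Function.Injective expNeg := fun x y h => by
  simpa using EReal.exp_strictMono.injective (inv_injective h)

theorem expNeg_le_one (x : ℝ≥0∞) : expNeg x ≤ 1 := by
  rw [expNeg, ENNReal.inv_le_one, EReal.one_le_exp_iff]
  exact EReal.coe_ennreal_nonneg x

theorem expNeg_ne_top (x : ℝ≥0∞) : expNeg x ≠ ∞ :=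
  ((expNeg_le_one x).trans_lt ENNReal.one_lt_top).ne

theorem expNeg_eq_zero_iff {x : ℝ≥0∞} : expNeg x = 0 ↔ x = ∞ := by
  rw [← expNeg_top, expNeg_injective.eq_iff]

theorem expNeg_eq_one_iff {x : ℝ≥0∞} : expNeg x = 1 ↔ x = 0 := by
  rw [← expNeg_zero, expNeg_injective.eq_iff]

theorem expNeg_sum {ι : Type*} (s : Finset ι) (f : ι → ℝ≥0∞) :
    expNeg (∑ i ∈ s, f i) = ∏ i ∈ s, expNeg (f i) := by
  classical
  induction s using Finset.induction_on with
  | empty => simp [expNeg_zero]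
  | insert a s ha ih => rw [Finset.sum_insert ha, Finset.prod_insert ha, expNeg_add, ih]

theorem expNeg_mul_natCast (x : ℝ≥0∞) (n : ℕ) : expNeg (x * n) = expNeg x ^ n := by
  rw [← Finset.card_range n, ← Finset.prod_const, ← expNeg_sum, Finset.sum_const, nsmul_eq_mul,
    mul_comm]

/-- The inverse of `expNeg` on `[0, 1]`. -/
noncomputable def negLog (x : ℝ≥0∞) : ℝ≥0∞ := (ENNReal.log x⁻¹).toENNReal

theorem measurable_negLog : Measurable negLog :=
  (measurable_inv.ennreal_log).ereal_toENNReal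

theorem expNeg_negLog {x : ℝ≥0∞} (hx : x ≤ 1) : expNeg (negLog x) = x := by
  rw [expNeg, negLog, EReal.coe_toENNReal, ENNReal.exp_log, inv_inv]
  simpa using hx

/-- With `q = e^(-c)` this is the generating function `𝐄 q^k = e^(-(1-q) r)`, by the exponential
series at `q r`. The value `c = ∞` is included: then `q = 0` and only the atom at zero contributes.
-/
theorem lintegral_expNeg_poissonMeasure (r : ℝ≥0) (c : ℝ≥0∞) :
    ∫⁻ k, expNeg (c * (k : ℕ)) ∂poissonMeasure r = expNeg ((1 - expNeg c) * r) := by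
  obtain ⟨q, hq⟩ : ∃ q : ℝ≥0, expNeg c = q := ⟨_, (ENNReal.coe_toNNReal (expNeg_ne_top c)).symm⟩
  have hq1 : q ≤ 1 := by exact_mod_cast hq ▸ expNeg_le_one c
  simp_rw [expNeg_mul_natCast, hq, poissonMeasure, lintegral_sum_measure, lintegral_smul_measure,
    lintegral_dirac]
  have : ((1 : ℝ≥0∞) - q) * r = (((1 - q) * r : ℝ≥0) : ℝ≥0∞) := by push_cast; rfl
  rw [this, expNeg_coe]
  have h : ∀ n : ℕ, ENNReal.ofReal (Real.exp (-r) * r ^ n / n.factorial) • (q : ℝ≥0∞) ^ n =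
      ENNReal.ofReal (Real.exp (-r) * ((q * r : ℝ) ^ n / n.factorial)) := fun n => by
    rw [smul_eq_mul, ← ENNReal.coe_pow, ← ENNReal.ofReal_coe_nnreal,
      ← ENNReal.ofReal_mul (by positivity)]
    congr 1
    push_cast
    ring
  have hs := (NormedSpace.expSeries_div_hasSum_exp (q * r : ℝ)).mul_left (Real.exp (-r))
  rw [← Real.exp_eq_exp_ℝ, ← Real.exp_add] at hs
  simp_rw [h]
  rw [← ENNReal.ofReal_tsum_of_nonneg (fun n => by positivity) hs.summable, hs.tsum_eq]
  congr 2
  push_cast [NNReal.coe_sub hq1]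
  ring

/-! ### The Laplace functional of a Poisson process. -/

section Laplace

variable {Ω E : Type*} [MeasurableSpace Ω] [MeasurableSpace E]

/-- The Laplace functional of `N` is that of a Poisson process with intensity measure `Λ`. -/
def HasPoissonLaplace (N : Ω → Measure E) (Λ : Measure E) (μ : Measure Ω) : Prop :=
  ∀ f : E → ℝ≥0∞, Measurable f →
    ∫⁻ ω, expNeg (∫⁻ x, f x ∂N ω) ∂μ = expNeg (∫⁻ x, 1 - expNeg (f x) ∂Λ)

variable {N : Ω → Measure E} {Λ : Measure E} {μ : Measure Ω}

theorem SINRNetwork.IsPoissonProcess.measurable_apply (h : IsPoissonProcess N Λ μ) {B : Set E}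
    (hB : MeasurableSet B) : Measurable fun ω => N ω B :=
  (Measure.measurable_coe hB).comp h.measurable

/-- For finite mean this is the Poisson transform. For infinite mean the count is almost surely
infinite, so both sides are `0`, except that both are `1` when `c = 0`. -/
theorem SINRNetwork.IsPoissonProcess.lintegral_expNeg_apply [IsProbabilityMeasure μ]
    (h : IsPoissonProcess N Λ μ) {B : Set E} (hB : MeasurableSet B) (c : ℝ≥0∞) :
    ∫⁻ ω, expNeg (c * N ω B) ∂μ = expNeg ((1 - expNeg c) * Λ B) := by
  by_cases hΛ : Λ B = ∞
  · have h1 : ∀ᵐ ω ∂μ, expNeg (c * N ω B) = expNeg (c * ∞) := by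
      filter_upwards [h.eq_top_of_infinite B hB hΛ] with ω hω
      rw [hω]
    rw [lintegral_congr_ae h1, lintegral_const, measure_univ, mul_one, hΛ]
    by_cases hc : c = 0
    · simp [hc, expNeg_zero]
    · rw [ENNReal.mul_top hc, ENNReal.mul_top]
      rw [Ne, tsub_eq_zero_iff_le, not_le]
      exact lt_of_le_of_ne (expNeg_le_one c) fun h => hc (expNeg_eq_one_iff.1 h)
  · have hm : Measurable fun x => expNeg (c * x) := measurable_expNeg.comp (measurable_const_mul c)
    rw [← lintegral_map (f := fun x => expNeg (c * x)) hm (h.measurable_apply hB),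
      h.law_of_finite B hB hΛ, lintegral_map hm (measurable_of_countable _),
      lintegral_expNeg_poissonMeasure, ENNReal.coe_toNNReal hΛ]

theorem measurable_lintegral_randomMeasure (hN : Measurable N) {f : E → ℝ≥0∞} (hf : Measurable f) :
    Measurable fun ω => ∫⁻ x, f x ∂N ω :=
  (Measure.measurable_lintegral hf).comp hN

/-- The level sets of a simple function are disjoint, so the counts in them are independent and the
expectation of the product of exponentials factors. -/
theorem SINRNetwork.IsPoissonProcess.lintegral_expNeg_simpleFunc [IsProbabilityMeasure μ]
    (h : IsPoissonProcess N Λ μ) (f : SimpleFunc E ℝ≥0∞) :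
    ∫⁻ ω, expNeg (∫⁻ x, f x ∂N ω) ∂μ = expNeg (∫⁻ x, 1 - expNeg (f x) ∂Λ) := by
  let e := f.range.equivFin
  have key : ∀ (g : ℝ≥0∞ → ℝ≥0∞) (ν : Measure E),
      ∫⁻ x, g (f x) ∂ν = ∑ i, g (e.symm i) * ν (f ⁻¹' {(e.symm i : ℝ≥0∞)}) := fun g ν => by
    have h1 : ∫⁻ x, g (f x) ∂ν = ∫⁻ x, f.map g x ∂ν := rfl
    rw [h1, SimpleFunc.lintegral_eq_lintegral, SimpleFunc.map_lintegral, ← Finset.sum_coe_sort]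
    exact (Equiv.sum_comp e.symm fun c : f.range => g c * ν (f ⁻¹' {(c : ℝ≥0∞)})).symm
  have hB : ∀ i, MeasurableSet (f ⁻¹' {(e.symm i : ℝ≥0∞)}) := fun i => f.measurableSet_preimage _
  rw [key fun c => 1 - expNeg c]
  simp_rw [key fun c => c, expNeg_sum, ← h.lintegral_expNeg_apply (hB _)]
  have hi := h.indep _ (fun i => f ⁻¹' {(e.symm i : ℝ≥0∞)}) hB fun i j hij => by
    refine Disjoint.preimage _ (disjoint_singleton.2 fun hc => hij ?_)
    exact e.symm.injective (Subtype.ext hc)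
  have hm : ∀ i, Measurable fun x => expNeg ((e.symm i : ℝ≥0∞) * x) := fun i =>
    measurable_expNeg.comp (measurable_const_mul _)
  exact lintegral_prod_eq_prod_lintegral_of_indepFun Finset.univ _
    (hi.comp (fun i x => expNeg ((e.symm i : ℝ≥0∞) * x)) hm)
    fun i => (hm i).comp (h.measurable_apply (hB i))

theorem tendsto_lintegral_expNeg [IsProbabilityMeasure μ] {F : ℕ → Ω → ℝ≥0∞} {f : Ω → ℝ≥0∞}
    (hF : ∀ n, Measurable (F n)) (h : ∀ ω, Tendsto (fun n => F n ω) atTop (𝓝 (f ω))) :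
    Tendsto (fun n => ∫⁻ ω, expNeg (F n ω) ∂μ) atTop (𝓝 (∫⁻ ω, expNeg (f ω) ∂μ)) := by
  refine tendsto_lintegral_of_dominated_convergence (fun _ => 1)
    (fun n => measurable_expNeg.comp (hF n)) (fun n => .of_forall fun ω => expNeg_le_one _)
    (by simp) (.of_forall fun ω => (continuous_expNeg.tendsto _).comp (h ω))

theorem expNeg_antitone : Antitone expNeg := fun x y h => by
  rw [expNeg, expNeg, ENNReal.inv_le_inv, EReal.exp_le_exp_iff]
  exact_mod_cast h

/-- Simple functions increase to `f`. Monotone convergence handles the integrals against `N` and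
`Λ`; the outer expectation converges by domination, as `expNeg` is continuous and bounded by `1`. -/
theorem SINRNetwork.IsPoissonProcess.hasPoissonLaplace [IsProbabilityMeasure μ]
    (h : IsPoissonProcess N Λ μ) : HasPoissonLaplace N Λ μ := fun f hf => by
  have hmono : ∀ x, Monotone fun n => SimpleFunc.eapprox f n x := fun x m n hmn =>
    SimpleFunc.monotone_eapprox f hmn x
  have hlim : ∀ x, Tendsto (fun n => SimpleFunc.eapprox f n x) atTop (𝓝 (f x)) := fun x => by
    have := tendsto_atTop_iSup (hmono x)
    rwa [SimpleFunc.iSup_eapprox_apply hf] at this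
  have h1 : ∀ ω, Tendsto (fun n => ∫⁻ x, SimpleFunc.eapprox f n x ∂N ω) atTop
      (𝓝 (∫⁻ x, f x ∂N ω)) := fun ω =>
    lintegral_tendsto_of_tendsto_of_monotone
      (fun n => (SimpleFunc.eapprox f n).measurable.aemeasurable)
      (.of_forall hmono) (.of_forall hlim)
  have h2 : Tendsto (fun n => ∫⁻ x, 1 - expNeg (SimpleFunc.eapprox f n x) ∂Λ) atTop
      (𝓝 (∫⁻ x, 1 - expNeg (f x) ∂Λ)) := by
    refine lintegral_tendsto_of_tendsto_of_monotone (fun n => ?_) (.of_forall fun x => ?_)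
      (.of_forall fun x => ?_)
    · exact (measurable_const.sub
        (measurable_expNeg.comp (SimpleFunc.eapprox f n).measurable)).aemeasurable
    · exact fun m n hmn => tsub_le_tsub_left (expNeg_antitone (hmono x hmn)) _
    · exact ENNReal.Tendsto.sub tendsto_const_nhds
        ((continuous_expNeg.tendsto _).comp (hlim x)) (.inl ENNReal.one_ne_top)
  have h3 := tendsto_lintegral_expNeg (μ := μ) (fun n =>
    measurable_lintegral_randomMeasure h.measurable (SimpleFunc.eapprox f n).measurable) h1
  simp_rw [h.lintegral_expNeg_simpleFunc] at h3
  exact tendsto_nhds_unique h3 ((continuous_expNeg.tendsto _).comp h2)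

end Laplace

/-! ### Uniqueness of Laplace transforms of finite measures on `[0, ∞]ⁿ`. -/

section Uniqueness

theorem continuous_toReal_expNeg : Continuous fun x => (expNeg x).toReal :=
  ENNReal.continuousOn_toReal.comp_continuous continuous_expNeg expNeg_ne_top

/-- The bounded continuous function `x ↦ e ^ (-x i)`. -/
noncomputable def expNegCoord {ι : Type*} (i : ι) : BoundedContinuousFunction (ι → ℝ≥0∞) ℝ :=
  BoundedContinuousFunction.ofNormedAddCommGroup (fun x => (expNeg (x i)).toReal)
    (continuous_toReal_expNeg.comp (continuous_apply i)) 1 fun x => by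
      rw [Real.norm_of_nonneg ENNReal.toReal_nonneg]
      exact ENNReal.toReal_mono ENNReal.one_ne_top (expNeg_le_one _)

theorem expNegCoord_apply {ι : Type*} (i : ι) (x : ι → ℝ≥0∞) :
    expNegCoord i x = (expNeg (x i)).toReal := rfl

/-- Monomials in the functions `e^(-x i)` are exponentials of integer linear forms. This is why
transforms at natural-number arguments suffice for uniqueness. -/
theorem exists_eq_expNeg_of_mem_closure {ι : Type*} [Fintype ι]
    {g : BoundedContinuousFunction (ι → ℝ≥0∞) ℝ}
    (hg : g ∈ Submonoid.closure (range (expNegCoord (ι := ι)))) :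
    ∃ k : ι → ℕ, ∀ x, g x = (expNeg (∑ i, (k i : ℝ≥0∞) * x i)).toReal := by
  classical
  induction hg using Submonoid.closure_induction with
  | mem g hg =>
    obtain ⟨i, rfl⟩ := hg
    refine ⟨Pi.single i 1, fun x => ?_⟩
    rw [expNegCoord_apply, Finset.sum_eq_single i]
    · simp
    · intro j _ hj
      simp [hj]
    · simp
  | one => exact ⟨0, fun x => by simp [expNeg_zero]⟩
  | mul f g _ _ hf hg =>
    obtain ⟨k, hk⟩ := hf
    obtain ⟨l, hl⟩ := hg
    refine ⟨k + l, fun x => ?_⟩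
    rw [BoundedContinuousFunction.mul_apply, hk, hl, ← ENNReal.toReal_mul, ← expNeg_add,
      ← Finset.sum_add_distrib]
    simp [add_mul]

theorem measurable_sum_mul {ι : Type*} [Fintype ι] (c : ι → ℝ≥0∞) :
    Measurable fun x : ι → ℝ≥0∞ => ∑ i, c i * x i :=
  Finset.univ.measurable_fun_sum fun i _ => (measurable_pi_apply i).const_mul _

/-- Finite measures on `[0, ∞]ⁿ` are determined by their Laplace transforms. -/
theorem measure_ext_of_laplace {ι : Type*} [Fintype ι] {P P' : Measure (ι → ℝ≥0∞)}
    [IsFiniteMeasure P] [IsFiniteMeasure P']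
    (h : ∀ k : ι → ℕ, ∫⁻ x, expNeg (∑ i, (k i : ℝ≥0∞) * x i) ∂P =
      ∫⁻ x, expNeg (∑ i, (k i : ℝ≥0∞) * x i) ∂P') : P = P' := by
  -- The coordinate exponentials generate an algebra that separates points, since `expNeg` is
  -- injective on all of `[0, ∞]`. Such an algebra determines finite measures on a Polish space.
  let A : StarSubalgebra ℝ (BoundedContinuousFunction (ι → ℝ≥0∞) ℝ) :=
    { Algebra.adjoin ℝ (range (expNegCoord (ι := ι))) with
      star_mem' := fun {g} hg => by
        have : star g = g := by ext x; simp
        rwa [this] }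
  refine ext_of_forall_mem_subalgebra_integral_eq_of_polish (𝕜 := ℝ) (A := A) ?_ ?_
  · intro x y hxy
    obtain ⟨i, hi⟩ := Function.ne_iff.1 hxy
    refine ⟨expNegCoord i, ⟨_, ⟨expNegCoord i, Algebra.subset_adjoin ⟨i, rfl⟩, rfl⟩, rfl⟩, ?_⟩
    simp only [expNegCoord_apply]
    rw [Ne, ENNReal.toReal_eq_toReal_iff' (expNeg_ne_top _) (expNeg_ne_top _)]
    exact fun hc => hi (expNeg_injective hc)
  · intro g hg
    -- The algebra is the linear span of the monomials, so by linearity of the integral only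
    -- monomials need checking.
    have hg' : g ∈ Submodule.span ℝ (Submonoid.closure (range (expNegCoord (ι := ι))) :
        Set (BoundedContinuousFunction (ι → ℝ≥0∞) ℝ)) := by
      rw [← Algebra.adjoin_eq_span]; exact hg
    clear hg
    induction hg' using Submodule.span_induction with
    | mem g hg =>
      obtain ⟨k, hk⟩ := exists_eq_expNeg_of_mem_closure hg
      have hm := (measurable_sum_mul fun i => (k i : ℝ≥0∞)).expNeg
      simp_rw [hk]
      rw [integral_toReal hm.aemeasurable (.of_forall fun x => (expNeg_ne_top _).lt_top),
        integral_toReal hm.aemeasurable (.of_forall fun x => (expNeg_ne_top _).lt_top)]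
      exact congrArg _ (h k)
    | zero => simp
    | add f g _ _ hf hg =>
      simp only [BoundedContinuousFunction.coe_add, Pi.add_apply]
      rw [integral_add (f.integrable _) (g.integrable _),
        integral_add (f.integrable _) (g.integrable _), hf, hg]
    | smul c f _ hf =>
      simp only [BoundedContinuousFunction.coe_smul]
      rw [integral_smul, integral_smul, hf]

theorem measure_ext_of_laplace_one {P P' : Measure ℝ≥0∞} [IsFiniteMeasure P] [IsFiniteMeasure P']
    (h : ∀ k : ℕ, ∫⁻ x, expNeg (k * x) ∂P = ∫⁻ x, expNeg (k * x) ∂P') : P = P' := by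
  let e := (MeasurableEquiv.funUnique Unit ℝ≥0∞).symm
  refine e.measurableEmbedding.map_injective (measure_ext_of_laplace fun k => ?_)
  rw [e.measurableEmbedding.lintegral_map, e.measurableEmbedding.lintegral_map]
  simpa [e] using h (k ())

end Uniqueness

/-! ### From Laplace functionals back to Poisson processes and laws of random measures. -/

theorem one_sub_expNeg_sum_indicator {ι E : Type*} [Fintype ι] {B : ι → Set E}
    (hB : Pairwise fun i j => Disjoint (B i) (B j)) (c : ι → ℝ≥0∞) (x : E) :
    1 - expNeg (∑ i, (B i).indicator (fun _ => c i) x) =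
      ∑ i, (B i).indicator (fun _ => 1 - expNeg (c i)) x := by
  by_cases h : ∃ i, x ∈ B i
  · obtain ⟨i, hi⟩ := h
    have hj : ∀ j, j ≠ i → x ∉ B j := fun j hj hx => disjoint_left.1 (hB hj) hx hi
    rw [Finset.sum_eq_single i, Finset.sum_eq_single i]
    · simp [hi]
    · exact fun j _ h => indicator_of_notMem (hj j h) _
    · simp
    · exact fun j _ h => indicator_of_notMem (hj j h) _
    · simp
  · push Not at h
    simp [h, expNeg_zero]

section RandomMeasure

variable {Ω Ω' E : Type*} [MeasurableSpace Ω] [MeasurableSpace Ω'] [MeasurableSpace E]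
  {N : Ω → Measure E} {N' : Ω' → Measure E} {Λ : Measure E} {μ : Measure Ω} {μ' : Measure Ω'}

theorem lintegral_sum_indicator {ι : Type*} [Fintype ι] {B : ι → Set E}
    (hB : ∀ i, MeasurableSet (B i)) (c : ι → ℝ≥0∞) (ν : Measure E) :
    ∫⁻ x, ∑ i, (B i).indicator (fun _ => c i) x ∂ν = ∑ i, c i * ν (B i) := by
  rw [lintegral_finsetSum _ fun i _ => measurable_const.indicator (hB i)]
  simp_rw [lintegral_indicator_const (hB _)]

theorem measurable_sum_indicator {ι : Type*} [Fintype ι] {B : ι → Set E}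
    (hB : ∀ i, MeasurableSet (B i)) (c : ι → ℝ≥0∞) :
    Measurable fun x => ∑ i, (B i).indicator (fun _ => c i) x :=
  Finset.univ.measurable_fun_sum fun i _ => measurable_const.indicator (hB i)

theorem HasPoissonLaplace.lintegral_expNeg_sum {ι : Type*} [Fintype ι]
    (h : HasPoissonLaplace N Λ μ) {B : ι → Set E} (hB : ∀ i, MeasurableSet (B i))
    (hd : Pairwise fun i j => Disjoint (B i) (B j)) (c : ι → ℝ≥0∞) :
    ∫⁻ ω, expNeg (∑ i, c i * N ω (B i)) ∂μ = ∏ i, expNeg ((1 - expNeg (c i)) * Λ (B i)) := by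
  have := h _ (measurable_sum_indicator hB c)
  simp_rw [lintegral_sum_indicator hB, one_sub_expNeg_sum_indicator hd,
    lintegral_sum_indicator hB, expNeg_sum] at this
  simpa only [expNeg_sum] using this

theorem HasPoissonLaplace.lintegral_expNeg (h : HasPoissonLaplace N Λ μ) {B : Set E}
    (hB : MeasurableSet B) (c : ℝ≥0∞) :
    ∫⁻ ω, expNeg (c * N ω B) ∂μ = expNeg ((1 - expNeg c) * Λ B) := by
  simpa using h.lintegral_expNeg_sum (ι := Unit) (B := fun _ => B) (fun _ => hB)
    Subsingleton.pairwise fun _ => c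

/-- Testing the functional on combinations of indicators of disjoint sets yields the joint Laplace
transform of the counts, which is the product of Poisson transforms. -/
theorem HasPoissonLaplace.isPoissonProcess [IsProbabilityMeasure μ] (h : HasPoissonLaplace N Λ μ)
    (hN : Measurable N) : IsPoissonProcess N Λ μ := by
  have hm : ∀ {B : Set E}, MeasurableSet B → Measurable fun ω => N ω B := fun hB =>
    (Measure.measurable_coe hB).comp hN
  refine ⟨hN, fun B hB hΛ => ?_, fun B hB hΛ => ?_, fun n B hB hd => ?_⟩
  · have : IsProbabilityMeasure (μ.map fun ω => N ω B) :=
      Measure.isProbabilityMeasure_map (hm hB).aemeasurable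
    have : IsProbabilityMeasure ((poissonMeasure (Λ B).toNNReal).map fun k : ℕ => (k : ℝ≥0∞)) :=
      Measure.isProbabilityMeasure_map (measurable_of_countable _).aemeasurable
    refine measure_ext_of_laplace_one fun k => ?_
    have hk : Measurable fun x => expNeg ((k : ℝ≥0∞) * x) :=
      measurable_expNeg.comp (measurable_const_mul _)
    rw [lintegral_map hk (hm hB), lintegral_map hk (measurable_of_countable _),
      h.lintegral_expNeg hB, lintegral_expNeg_poissonMeasure, ENNReal.coe_toNNReal hΛ]
  · have h1 := h.lintegral_expNeg hB 1
    have h0 : (1 : ℝ≥0∞) - expNeg 1 ≠ 0 := by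
      rw [Ne, tsub_eq_zero_iff_le, not_le]
      exact lt_of_le_of_ne (expNeg_le_one 1) fun h => one_ne_zero (expNeg_eq_one_iff.1 h)
    rw [hΛ, ENNReal.mul_top h0, expNeg_top,
      lintegral_eq_zero_iff ((hm hB).const_mul 1).expNeg] at h1
    filter_upwards [h1] with ω hω
    simpa using expNeg_eq_zero_iff.1 hω
  · rw [iIndepFun_iff_map_fun_eq_pi_map fun i => (hm (hB i)).aemeasurable]
    have hmi : Measurable fun ω i => N ω (B i) := measurable_pi_lambda _ fun i => hm (hB i)
    have h1 : ∀ i, IsProbabilityMeasure (μ.map fun ω => N ω (B i)) := fun i =>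
      Measure.isProbabilityMeasure_map (hm (hB i)).aemeasurable
    have : IsProbabilityMeasure (μ.map fun ω i => N ω (B i)) :=
      Measure.isProbabilityMeasure_map hmi.aemeasurable
    refine measure_ext_of_laplace fun k => ?_
    have hk : ∀ i, Measurable fun x => expNeg ((k i : ℝ≥0∞) * x) := fun i =>
      measurable_expNeg.comp (measurable_const_mul _)
    rw [lintegral_map (measurable_sum_mul _).expNeg hmi,
      h.lintegral_expNeg_sum hB hd]
    simp_rw [expNeg_sum]
    rw [lintegral_prod_eq_prod_lintegral_of_indepFun Finset.univ
      (fun i (x : Fin n → ℝ≥0∞) => expNeg ((k i : ℝ≥0∞) * x i))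
      (iIndepFun_pi (X := fun i x => expNeg ((k i : ℝ≥0∞) * x)) fun i => (hk i).aemeasurable)
      fun i => (hk i).comp (measurable_pi_apply i)]
    refine Finset.prod_congr rfl fun i _ => ?_
    rw [← h.lintegral_expNeg (hB i), ← lintegral_map (hk i) (hm (hB i))]
    exact ((measurePreserving_eval (fun i => μ.map fun ω => N ω (B i)) i).lintegral_comp
      (hk i)).symm

/-- The law of a random measure is determined by its Laplace functional. -/
theorem identDistrib_of_laplace [IsProbabilityMeasure μ] [IsProbabilityMeasure μ']
    (hN : Measurable N) (hN' : Measurable N')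
    (h : ∀ f : E → ℝ≥0∞, Measurable f →
      ∫⁻ ω, expNeg (∫⁻ x, f x ∂N ω) ∂μ = ∫⁻ ω, expNeg (∫⁻ x, f x ∂N' ω) ∂μ') :
    IdentDistrib N N' μ μ' := by
  refine ⟨hN.aemeasurable, hN'.aemeasurable, ?_⟩
  let Φ : Measure E → {B : Set E // MeasurableSet B} → ℝ≥0∞ := fun ν B => ν B
  have hΦ : Measurable Φ := measurable_pi_lambda _ fun B => Measure.measurable_coe B.2
  -- Evaluations on measurable sets generate the σ-algebra on measures, so it is enough to compare
  -- the laws of the family of all counts.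
  have hcomap : (inferInstance : MeasurableSpace (Measure E)) =
      MeasurableSpace.comap Φ inferInstance := by
    refine le_antisymm ?_ hΦ.comap_le
    refine iSup_le fun B => iSup_le fun hB => ?_
    rintro _ ⟨s, hs, rfl⟩
    exact ⟨(fun x => x ⟨B, hB⟩) ⁻¹' s, measurable_pi_apply (⟨B, hB⟩ : {B // MeasurableSet B}) hs,
      rfl⟩
  have key : (μ.map N).map Φ = (μ'.map N').map Φ := by
    have : IsProbabilityMeasure (μ.map N) := Measure.isProbabilityMeasure_map hN.aemeasurable
    have : IsProbabilityMeasure (μ'.map N') := Measure.isProbabilityMeasure_map hN'.aemeasurable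
    have : IsProbabilityMeasure ((μ.map N).map Φ) :=
      Measure.isProbabilityMeasure_map hΦ.aemeasurable
    have : IsProbabilityMeasure ((μ'.map N').map Φ) :=
      Measure.isProbabilityMeasure_map hΦ.aemeasurable
    -- Finite-dimensional marginals determine a law on the product space. Each one is fixed by its
    -- Laplace transform, which is the functional at a finite sum of indicators; the sets need not
    -- be disjoint here.
    refine IsProjectiveLimit.unique (P := fun I => ((μ.map N).map Φ).map I.restrict)
      (fun I => rfl) fun I => ?_
    refine (measure_ext_of_laplace fun k => ?_).symm
    have hI : Measurable (I.restrict (π := fun _ => ℝ≥0∞)) := Finset.measurable_restrict I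
    have hB : ∀ i : I, MeasurableSet (i.1 : Set E) := fun i => i.1.2
    have hk := (measurable_sum_mul fun i : I => (k i : ℝ≥0∞)).expNeg
    have hf := h _ (measurable_sum_indicator hB fun i => (k i : ℝ≥0∞))
    simp_rw [lintegral_sum_indicator hB] at hf
    beta_reduce
    rw [Measure.map_map hI hΦ, Measure.map_map hI hΦ, Measure.map_map (hI.comp hΦ) hN,
      Measure.map_map (hI.comp hΦ) hN', lintegral_map hk ((hI.comp hΦ).comp hN),
      lintegral_map hk ((hI.comp hΦ).comp hN')]
    exact hf
  ext A hA
  obtain ⟨s, hs, rfl⟩ : MeasurableSet[MeasurableSpace.comap Φ inferInstance] A := hcomap ▸ hA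
  rw [← Measure.map_apply hΦ hs, key, Measure.map_apply hΦ hs]

theorem SINRNetwork.IsPoissonProcess.identDistrib [IsProbabilityMeasure μ] [IsProbabilityMeasure μ']
    (h : IsPoissonProcess N Λ μ) (h' : IsPoissonProcess N' Λ μ') : IdentDistrib N N' μ μ' :=
  identDistrib_of_laplace h.measurable h'.measurable fun f hf => by
    rw [h.hasPoissonLaplace f hf, h'.hasPoissonLaplace f hf]

theorem SINRNetwork.IsPoissonProcess.map {F : Type*} [MeasurableSpace F]
    (h : IsPoissonProcess N Λ μ) {g : E → F} (hg : Measurable g) :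
    IsPoissonProcess (fun ω => (N ω).map g) (Λ.map g) μ := by
  refine ⟨(Measure.measurable_map g hg).comp h.measurable, fun B hB hΛ => ?_, fun B hB hΛ => ?_,
    fun n B hB hd => ?_⟩
  · rw [Measure.map_apply hg hB] at hΛ ⊢
    simp_rw [Measure.map_apply hg hB]
    exact h.law_of_finite _ (hg hB) hΛ
  · rw [Measure.map_apply hg hB] at hΛ
    simp_rw [Measure.map_apply hg hB]
    exact h.eq_top_of_infinite _ (hg hB) hΛ
  · simp_rw [Measure.map_apply hg (hB _)]
    exact h.indep n _ (fun i => hg (hB i)) fun i j hij => (hd hij).preimage g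

end RandomMeasure

/-! ### Counting processes of sequences and the marking theorem. -/

theorem countingProcess_apply {Ω E : Type*} [MeasurableSpace E]
    (x : ℕ → Ω → E) (ω : Ω) {B : Set E} (hB : MeasurableSet B) :
    countingProcess x ω B = ∑' n, B.indicator (fun _ => (1 : ℝ≥0∞)) (x n ω) := by
  rw [countingProcess, Measure.sum_apply _ hB]
  exact tsum_congr fun n => Measure.dirac_apply' _ hB

theorem lintegral_countingProcess {Ω E : Type*} [MeasurableSpace E]
    (x : ℕ → Ω → E) (ω : Ω) {f : E → ℝ≥0∞} (hf : Measurable f) :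
    ∫⁻ y, f y ∂(countingProcess x ω) = ∑' n, f (x n ω) := by
  rw [countingProcess, lintegral_sum_measure]
  exact tsum_congr fun n => lintegral_dirac' _ hf

theorem map_countingProcess {Ω E F : Type*} [MeasurableSpace E] [MeasurableSpace F]
    (x : ℕ → Ω → E) (ω : Ω) {g : E → F}
    (hg : Measurable g) :
    (countingProcess x ω).map g = countingProcess (fun n ω => g (x n ω)) ω := by
  rw [countingProcess, countingProcess, Measure.map_sum hg.aemeasurable]
  simp_rw [Measure.map_dirac' hg]

section Marking

variable {Ω E M : Type*} [MeasurableSpace Ω] [MeasurableSpace E] [MeasurableSpace M]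
  {μ : Measure Ω}

theorem measurable_countingProcess {x : ℕ → Ω → E} (hx : ∀ n, Measurable (x n)) :
    Measurable (countingProcess x) := by
  refine Measure.measurable_of_measurable_coe _ fun B hB => ?_
  simp_rw [countingProcess_apply x _ hB]
  exact Measurable.tsum fun n => (measurable_const.indicator hB).comp (hx n)

theorem SINRNetwork.IsPoissonProcess.congr [IsProbabilityMeasure μ] {N N' : Ω → Measure E}
    {Λ : Measure E} (h : IsPoissonProcess N Λ μ) (hN' : Measurable N') (hNN' : N =ᵐ[μ] N') :
    IsPoissonProcess N' Λ μ := by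
  refine HasPoissonLaplace.isPoissonProcess (fun f hf => ?_) hN'
  rw [← h.hasPoissonLaplace f hf]
  refine lintegral_congr_ae ?_
  filter_upwards [hNN'] with ω hω
  rw [hω]

namespace SINRNetwork.IsIndependentMarking

variable {x : ℕ → Ω → E} {m : ℕ → Ω → M} {Q : Measure M}

theorem isProbabilityMeasure [IsProbabilityMeasure μ] (h : IsIndependentMarking x m Q μ) :
    IsProbabilityMeasure Q :=
  h.law_mark 0 ▸ Measure.isProbabilityMeasure_map (h.measurable_mark 0).aemeasurable

theorem measurable_points (h : IsIndependentMarking x m Q μ) : Measurable fun ω n => x n ω :=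
  measurable_pi_lambda _ h.measurable_point

theorem measurable_marks (h : IsIndependentMarking x m Q μ) : Measurable fun ω n => m n ω :=
  measurable_pi_lambda _ h.measurable_mark

theorem map_marks [IsProbabilityMeasure μ] (h : IsIndependentMarking x m Q μ) :
    μ.map (fun ω n => m n ω) = Measure.infinitePi fun _ => Q := by
  rw [(iIndepFun_iff_map_fun_eq_infinitePi_map h.measurable_mark).1 h.indep_marks]
  simp_rw [h.law_mark]

theorem map_points_marks [IsProbabilityMeasure μ] (h : IsIndependentMarking x m Q μ) :
    μ.map (fun ω => (fun n => x n ω, fun n => m n ω)) =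
      (μ.map fun ω n => x n ω).prod (Measure.infinitePi fun _ => Q) := by
  rw [h.indep_points_marks.map_prod_eq_prod_map_map h.measurable_points.aemeasurable
    h.measurable_marks.aemeasurable, h.map_marks]

/-- The joint law of points and marks is a product. By Fubini the points can be frozen, and for
frozen points the factors are independent. -/
theorem lintegral_prod [IsProbabilityMeasure μ] (h : IsIndependentMarking x m Q μ)
    {f : E × M → ℝ≥0∞} (hf : Measurable f) (s : Finset ℕ) :
    ∫⁻ ω, ∏ n ∈ s, f (x n ω, m n ω) ∂μ = ∫⁻ ω, ∏ n ∈ s, ∫⁻ t, f (x n ω, t) ∂Q ∂μ := by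
  have := h.isProbabilityMeasure
  have : IsProbabilityMeasure (μ.map fun ω n => x n ω) :=
    Measure.isProbabilityMeasure_map h.measurable_points.aemeasurable
  have hF : Measurable fun p : (ℕ → E) × (ℕ → M) => ∏ n ∈ s, f (p.1 n, p.2 n) :=
    s.measurable_fun_prod fun n _ => hf.comp (by fun_prop)
  have hG : Measurable fun a : E => ∫⁻ t, f (a, t) ∂Q := hf.lintegral_prod_right'
  have hG' : Measurable fun a : ℕ → E => ∏ n ∈ s, ∫⁻ t, f (a n, t) ∂Q :=
    s.measurable_fun_prod fun n _ => hG.comp (measurable_pi_apply n)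
  calc ∫⁻ ω, ∏ n ∈ s, f (x n ω, m n ω) ∂μ
      = ∫⁻ p, ∏ n ∈ s, f (p.1 n, p.2 n) ∂μ.map fun ω => (fun n => x n ω, fun n => m n ω) :=
        (lintegral_map hF (h.measurable_points.prodMk h.measurable_marks)).symm
    _ = ∫⁻ a, ∫⁻ b, ∏ n ∈ s, f (a n, b n) ∂Measure.infinitePi (fun _ => Q)
          ∂μ.map fun ω n => x n ω := by
        rw [h.map_points_marks, MeasureTheory.lintegral_prod _ hF.aemeasurable]
    _ = ∫⁻ a, ∏ n ∈ s, ∫⁻ t, f (a n, t) ∂Q ∂μ.map fun ω n => x n ω := by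
        refine lintegral_congr fun a => ?_
        have hfa : ∀ n, Measurable fun t => f (a n, t) := fun n => hf.comp measurable_prodMk_left
        rw [lintegral_prod_eq_prod_lintegral_of_indepFun s (fun n (b : ℕ → M) => f (a n, b n))
          (iIndepFun_infinitePi (X := fun n t => f (a n, t)) hfa)
          fun n => (hfa n).comp (measurable_pi_apply n)]
        exact Finset.prod_congr rfl fun n _ =>
          (measurePreserving_eval_infinitePi (fun _ => Q) n).lintegral_comp (hfa n)
    _ = ∫⁻ ω, ∏ n ∈ s, ∫⁻ t, f (x n ω, t) ∂Q ∂μ := lintegral_map hG' h.measurable_points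

/-- The marking theorem. -/
theorem isPoisson_marked [IsProbabilityMeasure μ] (h : IsIndependentMarking x m Q μ)
    {Λ : Measure E} [SFinite Λ] (hx : IsPoissonProcess (countingProcess x) Λ μ) :
    IsPoissonProcess (countingProcess fun n ω => (x n ω, m n ω)) (Λ.prod Q) μ := by
  have := h.isProbabilityMeasure
  have hxm : ∀ n, Measurable fun ω => (x n ω, m n ω) := fun n =>
    (h.measurable_point n).prodMk (h.measurable_mark n)
  refine HasPoissonLaplace.isPoissonProcess (fun f hf => ?_) (measurable_countingProcess hxm)
  -- Averaging over the mark replaces `e^(-f)` by `g`, so the marked functional at `f` equals the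
  -- unmarked one at `-log g`, which is known.
  let g : E → ℝ≥0∞ := fun a => ∫⁻ t, expNeg (f (a, t)) ∂Q
  have hg : Measurable g := hf.expNeg.lintegral_prod_right'
  have hg1 : ∀ a, g a ≤ 1 := fun a =>
    (lintegral_mono fun t => expNeg_le_one _).trans (by simp)
  have hng : Measurable fun a => negLog (g a) := measurable_negLog.comp hg
  have hL := hx.hasPoissonLaplace _ hng
  simp_rw [lintegral_countingProcess _ _ hng, expNeg_negLog (hg1 _)] at hL
  simp_rw [lintegral_countingProcess _ _ hf]
  -- The averaging identity `h3` concerns finite products, so the infinite sums are reached as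
  -- limits of partial sums on both sides.
  have h1 := tendsto_lintegral_expNeg (μ := μ)
    (F := fun k ω => ∑ n ∈ Finset.range k, f (x n ω, m n ω))
    (fun k => Finset.measurable_fun_sum _ fun n _ => hf.comp (hxm n))
    fun ω => ENNReal.tendsto_nat_tsum fun n => f (x n ω, m n ω)
  have h2 := tendsto_lintegral_expNeg (μ := μ)
    (F := fun k ω => ∑ n ∈ Finset.range k, negLog (g (x n ω)))
    (fun k => Finset.measurable_fun_sum _ fun n _ => hng.comp (h.measurable_point n))
    fun ω => ENNReal.tendsto_nat_tsum fun n => negLog (g (x n ω))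
  have h3 : ∀ k, ∫⁻ ω, expNeg (∑ n ∈ Finset.range k, f (x n ω, m n ω)) ∂μ =
      ∫⁻ ω, expNeg (∑ n ∈ Finset.range k, negLog (g (x n ω))) ∂μ := fun k => by
    simp_rw [expNeg_sum, expNeg_negLog (hg1 _)]
    exact h.lintegral_prod hf.expNeg _
  simp_rw [h3] at h1
  rw [tendsto_nhds_unique h1 h2, hL, MeasureTheory.lintegral_prod (fun p => 1 - expNeg (f p))
    (measurable_const.sub hf.expNeg).aemeasurable]
  congr 1
  refine lintegral_congr fun a => ?_
  have hfa : Measurable fun t => expNeg (f (a, t)) := hf.expNeg.comp measurable_prodMk_left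
  rw [lintegral_sub hfa ((hg1 a).trans_lt ENNReal.one_lt_top).ne
    (.of_forall fun t => expNeg_le_one _)]
  simp [g]

end SINRNetwork.IsIndependentMarking

theorem lintegral_natCast_poissonMeasure (r : ℝ≥0) :
    ∫⁻ k, (k : ℕ) ∂poissonMeasure r = (r : ℝ≥0∞) := by
  simp_rw [poissonMeasure, lintegral_sum_measure, lintegral_smul_measure, lintegral_dirac]
  have h : ∀ n : ℕ, ENNReal.ofReal (Real.exp (-r) * r ^ (n + 1) / (n + 1).factorial) •
      ((n + 1 : ℕ) : ℝ≥0∞) =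
      ENNReal.ofReal (Real.exp (-r) * r * ((r : ℝ) ^ n / n.factorial)) := fun n => by
    rw [smul_eq_mul, ← ENNReal.ofReal_natCast, ← ENNReal.ofReal_mul (by positivity)]
    congr 1
    rw [Nat.factorial_succ]
    push_cast
    field_simp
    ring
  have hs := (NormedSpace.expSeries_div_hasSum_exp (r : ℝ)).mul_left (Real.exp (-r) * r)
  rw [← Real.exp_eq_exp_ℝ, mul_right_comm, ← Real.exp_add, neg_add_cancel, Real.exp_zero,
    one_mul] at hs
  rw [tsum_eq_zero_add' ENNReal.summable]
  simp_rw [h]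
  rw [← ENNReal.ofReal_tsum_of_nonneg (fun n => by positivity) hs.summable, hs.tsum_eq]
  simp

theorem SINRNetwork.IsPoissonProcess.lintegral_apply [IsProbabilityMeasure μ] {N : Ω → Measure E}
    {Λ : Measure E} (h : IsPoissonProcess N Λ μ) {B : Set E} (hB : MeasurableSet B) :
    ∫⁻ ω, N ω B ∂μ = Λ B := by
  by_cases hΛ : Λ B = ∞
  · rw [lintegral_congr_ae (h.eq_top_of_infinite B hB hΛ), hΛ]
    simp
  · rw [← lintegral_map (f := fun x => x) measurable_id (h.measurable_apply hB),
      h.law_of_finite B hB hΛ, lintegral_map (f := fun x => x) measurable_id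
      (measurable_of_countable _), lintegral_natCast_poissonMeasure, ENNReal.coe_toNNReal hΛ]

end Marking

/-! ### Measurable sorting of locally finite point sequences. -/

section Ordering

/-- The points of `w` can be enumerated in increasing order of their first coordinates. -/
def Orderable (w : ℕ → ℝ × ℝ) : Prop :=
  Function.Injective (fun n => (w n).1) ∧ ∀ s : ℝ, {n | (w n).1 ≤ s}.Finite

/-- The number of points of `w` that precede `w k`. -/
noncomputable def rankSeq (w : ℕ → ℝ × ℝ) (k : ℕ) : ℝ≥0∞ :=
  ∑' j, if (w j).1 < (w k).1 then 1 else 0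

/-- The second alternative makes the search total: if no point has rank `n`, index `0` qualifies and
`sortSeq` takes the default value `w 0`. -/
theorem exists_rank (w : ℕ → ℝ × ℝ) (n : ℕ) :
    ∃ k, rankSeq w k = n ∨ ∀ j, rankSeq w j ≠ n := by
  by_contra! h
  obtain ⟨j, hj⟩ := (h 0).2
  exact (h j).1 hj

open Classical in
/-- The points of `w`, enumerated in increasing order of their first coordinates. -/
noncomputable def sortSeq (w : ℕ → ℝ × ℝ) (n : ℕ) : ℝ × ℝ := w (Nat.find (exists_rank w n))

theorem measurable_rankSeq (k : ℕ) : Measurable fun w => rankSeq w k := by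
  refine Measurable.tsum fun j => Measurable.ite (measurableSet_lt ?_ ?_) measurable_const
    measurable_const <;> fun_prop

theorem measurable_sortSeq : Measurable sortSeq := by
  classical
  refine measurable_pi_lambda _ fun n => ?_
  have h : ∀ k, MeasurableSet {w | rankSeq w k = (n : ℝ≥0∞)} := fun k =>
    measurable_rankSeq k (measurableSet_singleton _)
  refine Measurable.find (f := fun k (w : ℕ → ℝ × ℝ) => w k)
    (p := fun k w => rankSeq w k = n ∨ ∀ j, rankSeq w j ≠ n) (fun k => measurable_pi_apply k)
    (fun k => ?_) fun w => exists_rank w n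
  have h' : MeasurableSet {w | ∀ j, rankSeq w j ≠ (n : ℝ≥0∞)} := by
    rw [ofPred_forall]
    exact MeasurableSet.iInter fun j => (h j).compl
  exact (h k).union h'

theorem Orderable.exists_rank_equiv {w : ℕ → ℝ × ℝ} (h : Orderable w) :
    ∃ r : Equiv.Perm ℕ, (∀ k, rankSeq w k = r k) ∧
      ∀ j k, (w j).1 < (w k).1 → r j < r k := by
  have hfin : ∀ k, {j | (w j).1 < (w k).1}.Finite := fun k =>
    (h.2 (w k).1).subset fun j hj => by
      simp only [mem_ofPred_eq] at hj ⊢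
      exact hj.le
  let r : ℕ → ℕ := fun k => (hfin k).toFinset.card
  have hmono : ∀ j k, (w j).1 < (w k).1 → r j < r k := fun j k hjk => by
    refine Finset.card_lt_card ⟨fun i hi => ?_, fun hc => ?_⟩
    · simp only [Finite.mem_toFinset, mem_ofPred_eq] at hi ⊢
      exact hi.trans hjk
    · simpa using hc ((hfin k).mem_toFinset.2 hjk)
  have hinj : Function.Injective r := fun j k hjk => by
    by_contra hne
    rcases lt_or_gt_of_ne fun hc => hne (h.1 hc) with hlt | hlt
    · exact (hmono _ _ hlt).ne hjk
    · exact (hmono _ _ hlt).ne' hjk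
  -- Some `k` has rank above `n`, as the ranks are infinitely many. The points preceding it are `r
  -- k` in number and have distinct ranks below `r k`, so they exhaust these ranks, including `n`.
  have hsurj : Function.Surjective r := fun n => by
    obtain ⟨_, ⟨k, rfl⟩, hk⟩ := (infinite_range_of_injective hinj).exists_gt n
    have himage : (hfin k).toFinset.image r = Finset.range (r k) := by
      refine Finset.eq_of_subset_of_card_le (fun i hi => ?_) ?_
      · obtain ⟨j, hj, rfl⟩ := Finset.mem_image.1 hi
        exact Finset.mem_range.2 (hmono j k ((hfin k).mem_toFinset.1 hj))
      · rw [Finset.card_image_of_injective _ hinj, Finset.card_range]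
    obtain ⟨j, -, hj⟩ := Finset.mem_image.1 (himage ▸ Finset.mem_range.2 hk)
    exact ⟨j, hj⟩
  refine ⟨Equiv.ofBijective r ⟨hinj, hsurj⟩, fun k => ?_, hmono⟩
  rw [rankSeq, tsum_eq_sum (s := (hfin k).toFinset) (by simp)]
  have h1 : ∀ j ∈ (hfin k).toFinset, (if (w j).1 < (w k).1 then 1 else 0) = (1 : ℝ≥0∞) :=
    fun j hj => if_pos (by simpa using hj)
  rw [Finset.sum_congr rfl h1, Finset.sum_const, nsmul_eq_mul, mul_one]
  rfl

/-- Sequences of pairs with first coordinates that increase to infinity. -/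
def increasingSeq : Set (ℕ → ℝ × ℝ) :=
  {z | (∀ n, (z n).1 < (z (n + 1)).1) ∧ ∀ k : ℕ, ∃ n, (k : ℝ) < (z n).1}

theorem measurableSet_increasingSeq : MeasurableSet increasingSeq := by
  rw [increasingSeq, ofPred_and, ofPred_forall, ofPred_forall]
  refine (MeasurableSet.iInter fun n => measurableSet_lt ?_ ?_).inter
    (MeasurableSet.iInter fun k => ?_)
  · fun_prop
  · fun_prop
  · rw [ofPred_exists]
    exact MeasurableSet.iUnion fun n => measurableSet_lt measurable_const (by fun_prop)

theorem finite_lt_of_mem_increasingSeq {z : ℕ → ℝ × ℝ} (hz : z ∈ increasingSeq) (s : ℝ) :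
    {n | (z n).1 < s}.Finite := by
  obtain ⟨k, hk⟩ := exists_nat_ge s
  obtain ⟨m, hm⟩ := hz.2 k
  have hmono : StrictMono fun n => (z n).1 := strictMono_nat_of_lt_succ hz.1
  exact (finite_Iio m).subset fun n hn => hmono.lt_iff_lt.1 ((hn.trans_le hk).trans hm)

theorem Orderable.exists_sortSeq_eq {w : ℕ → ℝ × ℝ} (h : Orderable w) :
    ∃ r : Equiv.Perm ℕ, sortSeq w = w ∘ r.symm ∧ ∀ j k, (w j).1 < (w k).1 → r j < r k := by
  classical
  obtain ⟨r, hr, hmono⟩ := h.exists_rank_equiv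
  refine ⟨r, funext fun n => congrArg w ?_, hmono⟩
  rcases Nat.find_spec (exists_rank w n) with hs | hs
  · rw [hr] at hs
    exact r.injective (by simpa using hs)
  · exact absurd (by simp [hr]) (hs (r.symm n))

theorem Orderable.exists_perm {w : ℕ → ℝ × ℝ} (h : Orderable w) :
    ∃ σ : Equiv.Perm ℕ, sortSeq w = w ∘ σ :=
  let ⟨r, hr, _⟩ := h.exists_sortSeq_eq
  ⟨r.symm, hr⟩

theorem Orderable.sortSeq_mem {w : ℕ → ℝ × ℝ} (h : Orderable w) : sortSeq w ∈ increasingSeq := by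
  obtain ⟨r, hr, hmono⟩ := h.exists_sortSeq_eq
  rw [hr]
  refine ⟨fun n => ?_, fun k => ?_⟩
  · by_contra! hle
    rcases hle.lt_or_eq with hlt | heq
    · have := hmono _ _ hlt
      simp at this
    · have := h.1 heq
      simp at this
  · by_contra! hle
    refine infinite_univ ((h.2 k).subset fun n _ => ?_)
    simpa using hle (r n)

/-- The numbers of points in the sets of a countable basis. -/
noncomputable def basisCounts (ν : Measure (ℝ × ℝ))
    (B : TopologicalSpace.countableBasis (ℝ × ℝ)) : ℝ≥0∞ := ν B

theorem measurableSet_countableBasis (B : TopologicalSpace.countableBasis (ℝ × ℝ)) :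
    MeasurableSet (B : Set (ℝ × ℝ)) :=
  (TopologicalSpace.isOpen_of_mem_countableBasis B.2).measurableSet

theorem measurable_basisCounts : Measurable basisCounts :=
  measurable_pi_lambda _ fun B => Measure.measurable_coe (measurableSet_countableBasis B)

/-- The counting measure of a sequence. -/
noncomputable def seqMeasure {E : Type*} [MeasurableSpace E] : (ℕ → E) → Measure E :=
  countingProcess fun n z => z n

theorem seqMeasure_comp_perm {E : Type*} [MeasurableSpace E] (z : ℕ → E) (σ : Equiv.Perm ℕ) :
    seqMeasure (z ∘ σ) = seqMeasure z :=
  Measure.sum_comp_equiv σ fun n => Measure.dirac (z n)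

theorem Orderable.seqMeasure_sortSeq {z : ℕ → ℝ × ℝ} (hz : Orderable z) :
    seqMeasure (sortSeq z) = seqMeasure z := by
  obtain ⟨σ, hσ⟩ := hz.exists_perm
  rw [hσ, seqMeasure_comp_perm]

theorem measurable_seqMeasure {E : Type*} [MeasurableSpace E] :
    Measurable (seqMeasure (E := E)) :=
  measurable_countingProcess fun n => measurable_pi_apply n

theorem seqMeasure_ne_zero_iff {E : Type*} [MeasurableSpace E] {z : ℕ → E} {B : Set E}
    (hB : MeasurableSet B) : seqMeasure z B ≠ 0 ↔ ∃ n, z n ∈ B := by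
  rw [seqMeasure, countingProcess_apply _ _ hB, Ne, ENNReal.tsum_eq_zero]
  simp

/-- Local finiteness of `z'` allows a point of `z` to be isolated from all points of `z'` different
from it. A basis set in that neighbourhood has positive count, so it must contain a point of `z'`.
-/
theorem range_subset_of_basisCounts_eq {z z' : ℕ → ℝ × ℝ} (hz' : z' ∈ increasingSeq)
    (h : basisCounts (seqMeasure z) = basisCounts (seqMeasure z')) : range z ⊆ range z' := by
  rintro _ ⟨n, rfl⟩
  -- The margin `1` is arbitrary: the strip contains `z n` and only finitely many points of `z'`,
  -- which can be deleted leaving an open set.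
  let F := {k | (z' k).1 < (z n).1 + 1}
  have hF : (z' '' F).Finite := (finite_lt_of_mem_increasingSeq hz' _).image z'
  let U : Set (ℝ × ℝ) := {q | q.1 < (z n).1 + 1} ∩ (z' '' F \ {z n})ᶜ
  have hU : IsOpen U := (isOpen_lt continuous_fst continuous_const).inter
    hF.sdiff.isClosed.isOpen_compl
  have hnU : z n ∈ U := ⟨by simp, by simp⟩
  obtain ⟨V, hV, hnV, hVU⟩ :=
    (TopologicalSpace.isBasis_countableBasis (ℝ × ℝ)).exists_subset_of_mem_open hnU hU
  have hVm := measurableSet_countableBasis ⟨V, hV⟩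
  have h1 : seqMeasure z V ≠ 0 := (seqMeasure_ne_zero_iff hVm).2 ⟨n, hnV⟩
  have h2 : seqMeasure z V = seqMeasure z' V := congrFun h ⟨V, hV⟩
  obtain ⟨k, hk⟩ := (seqMeasure_ne_zero_iff hVm).1 (h2 ▸ h1)
  refine ⟨k, by_contra fun hne => ?_⟩
  exact (hVU hk).2 ⟨⟨k, (hVU hk).1, rfl⟩, hne⟩

/-- The counts fix the set of points, and a strictly increasing sequence is fixed by its range.
Distinct first coordinates then match the second coordinates. -/
theorem injOn_basisCounts : InjOn (fun z => basisCounts (seqMeasure z)) increasingSeq := by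
  intro z hz z' hz' h
  have hrange : range z = range z' := (range_subset_of_basisCounts_eq hz' h).antisymm
    (range_subset_of_basisCounts_eq hz h.symm)
  have hm : StrictMono fun n => (z n).1 := strictMono_nat_of_lt_succ hz.1
  have hm' : StrictMono fun n => (z' n).1 := strictMono_nat_of_lt_succ hz'.1
  have hfst : (fun n => (z n).1) = fun n => (z' n).1 := by
    rw [← hm.range_inj hm']
    have := congrArg (image Prod.fst) hrange
    rwa [← range_comp, ← range_comp] at this
  funext n
  obtain ⟨k, hk⟩ : z n ∈ range z' := hrange ▸ mem_range_self n
  have : k = n := hm'.injective (by rw [← congrFun hfst n]; exact congrArg Prod.fst hk)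
  rw [← hk, this]

/-- By Lusin-Souslin, `f` maps `A ∩ S` to a measurable set, and injectivity on `S` recovers `A` from
it up to a null set. -/
theorem measure_ext_of_map_eq_of_injOn {Z R : Type*} [MeasurableSpace Z] [StandardBorelSpace Z]
    [MeasurableSpace R] [MeasurableSpace.CountablySeparated R] {P P' : Measure Z} {S : Set Z}
    (hS : MeasurableSet S) (hP : ∀ᵐ z ∂P, z ∈ S) (hP' : ∀ᵐ z ∂P', z ∈ S) {f : Z → R}
    (hf : Measurable f) (hinj : InjOn f S) (h : P.map f = P'.map f) : P = P' := by
  ext A hA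
  have hAS : MeasurableSet (f '' (A ∩ S)) :=
    (hA.inter hS).image_of_measurable_injOn hf (hinj.mono inter_subset_right)
  have key : ∀ ν : Measure Z, (∀ᵐ z ∂ν, z ∈ S) → ν A = ν.map f (f '' (A ∩ S)) := fun ν hν => by
    rw [Measure.map_apply hf hAS]
    refine measure_congr ?_
    filter_upwards [hν] with z hz
    refine propext ⟨fun hzA => ⟨z, ⟨hzA, hz⟩, rfl⟩, ?_⟩
    rintro ⟨y, ⟨hyA, hyS⟩, hy⟩
    exact hinj hyS hz hy ▸ hyA
  rw [key P hP, key P' hP', h]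

variable {Ω Ω' : Type*} [MeasurableSpace Ω] [MeasurableSpace Ω'] {μ : Measure Ω} {μ' : Measure Ω'}
  {w : ℕ → Ω → ℝ × ℝ} {w' : ℕ → Ω' → ℝ × ℝ}

/-- The law of the ordered sequence of points is determined by the law of the point process. -/
theorem identDistrib_sortSeq (hw : ∀ n, Measurable (w n)) (hw' : ∀ n, Measurable (w' n))
    (ho : ∀ᵐ ω ∂μ, Orderable fun n => w n ω) (ho' : ∀ᵐ ω ∂μ', Orderable fun n => w' n ω)
    (h : IdentDistrib (countingProcess w) (countingProcess w') μ μ') :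
    IdentDistrib (fun ω => sortSeq fun n => w n ω) (fun ω => sortSeq fun n => w' n ω) μ μ' := by
  have hm : Measurable fun ω => sortSeq fun n => w n ω :=
    measurable_sortSeq.comp (measurable_pi_lambda _ hw)
  have hm' : Measurable fun ω => sortSeq fun n => w' n ω :=
    measurable_sortSeq.comp (measurable_pi_lambda _ hw')
  have hf : Measurable fun z => basisCounts (seqMeasure z) :=
    measurable_basisCounts.comp measurable_seqMeasure
  refine ⟨hm.aemeasurable, hm'.aemeasurable, measure_ext_of_map_eq_of_injOn
    measurableSet_increasingSeq ?_ ?_ hf injOn_basisCounts ?_⟩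
  · refine (ae_map_iff hm.aemeasurable measurableSet_increasingSeq).2 ?_
    exact ho.mono fun ω hω => hω.sortSeq_mem
  · refine (ae_map_iff hm'.aemeasurable measurableSet_increasingSeq).2 ?_
    exact ho'.mono fun ω hω => hω.sortSeq_mem
  · rw [Measure.map_map hf hm, Measure.map_map hf hm']
    have e : (fun z => basisCounts (seqMeasure z)) ∘ (fun ω => sortSeq fun n => w n ω) =ᵐ[μ]
        basisCounts ∘ countingProcess w :=
      ho.mono fun ω hω => congrArg basisCounts hω.seqMeasure_sortSeq
    have e' : (fun z => basisCounts (seqMeasure z)) ∘ (fun ω => sortSeq fun n => w' n ω) =ᵐ[μ']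
        basisCounts ∘ countingProcess w' :=
      ho'.mono fun ω hω => congrArg basisCounts hω.seqMeasure_sortSeq
    rw [Measure.map_congr e, Measure.map_congr e']
    exact (h.comp measurable_basisCounts).map_eq

/-- The law of a functional of the points that does not depend on their enumeration is determined
by the law of the point process. -/
theorem identDistrib_of_perm_invariant {F : Type*} [MeasurableSpace F]
    (hw : ∀ n, Measurable (w n)) (hw' : ∀ n, Measurable (w' n))
    (ho : ∀ᵐ ω ∂μ, Orderable fun n => w n ω) (ho' : ∀ᵐ ω ∂μ', Orderable fun n => w' n ω)
    (h : IdentDistrib (countingProcess w) (countingProcess w') μ μ')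
    {H : (ℕ → ℝ × ℝ) → F} (hH : Measurable H) (hinv : ∀ z (σ : Equiv.Perm ℕ), H (z ∘ σ) = H z) :
    IdentDistrib (fun ω => H fun n => w n ω) (fun ω => H fun n => w' n ω) μ μ' := by
  have hseq : ∀ z : ℕ → ℝ × ℝ, Orderable z → H (sortSeq z) = H z := fun z hz => by
    obtain ⟨σ, hσ⟩ := hz.exists_perm
    rw [hσ, hinv]
  have key := (identDistrib_sortSeq hw hw' ho ho' h).comp hH
  refine ((IdentDistrib.of_ae_eq key.aemeasurable_fst ?_).symm.trans key).trans
    (IdentDistrib.of_ae_eq key.aemeasurable_snd ?_)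
  · exact ho.mono fun ω hω => hseq _ hω
  · exact ho'.mono fun ω hω => hseq _ hω

end Ordering

/-! ### Simplicity and local finiteness of Poisson processes. -/

theorem two_le_countingProcess {Ω E : Type*} [MeasurableSpace E] {x : ℕ → Ω → E} {ω : Ω}
    {B : Set E} (hB : MeasurableSet B) {n m : ℕ} (hnm : n ≠ m) (hn : x n ω ∈ B) (hm : x m ω ∈ B) : 2 ≤ countingProcess x ω B := by
  rw [countingProcess_apply _ _ hB]
  refine le_trans ?_ (ENNReal.sum_le_tsum {n, m})
  rw [Finset.sum_pair hnm, indicator_of_mem hn, indicator_of_mem hm, one_add_one_eq_two]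

section Simple

variable {Ω E : Type*} [MeasurableSpace Ω] [MeasurableSpace E] {μ : Measure Ω}

/-- The probability is `1 - (1 + r) e^(-r)`, and `e^(-r) ≥ 1 - r` bounds it by `1 - (1 + r)(1 - r) =
r²`. -/
theorem poissonMeasure_two_le (r : ℝ≥0) : poissonMeasure r {k | 2 ≤ k} ≤ (r : ℝ≥0∞) ^ 2 := by
  have hset : {k : ℕ | 2 ≤ k} = ({0} ∪ {1})ᶜ := by
    ext k
    simp only [mem_ofPred_eq, mem_compl_iff, mem_union, mem_singleton_iff]
    omega
  have hreal : (poissonMeasure r).real {k | 2 ≤ k} ≤ (r : ℝ) ^ 2 := by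
    rw [hset, probReal_compl_eq_one_sub (MeasurableSet.of_discrete),
      measureReal_union (by simp) (MeasurableSet.of_discrete), poissonMeasure_real_singleton,
      poissonMeasure_real_singleton]
    have h1 := Real.add_one_le_exp (-(r : ℝ))
    have h2 : (0 : ℝ) ≤ 1 + r := by positivity
    have h3 := mul_le_mul_of_nonneg_left h1 h2
    norm_num
    nlinarith
  rw [← ENNReal.ofReal_toReal (measure_ne_top (poissonMeasure r) {k | 2 ≤ k}),
    ← ENNReal.ofReal_coe_nnreal, ← ENNReal.ofReal_pow r.coe_nonneg]
  exact ENNReal.ofReal_le_ofReal hreal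

theorem SINRNetwork.IsPoissonProcess.measure_two_le {N : Ω → Measure E} {Λ : Measure E}
    (h : IsPoissonProcess N Λ μ) {B : Set E} (hB : MeasurableSet B) (hΛ : Λ B ≠ ∞) :
    μ {ω | 2 ≤ N ω B} ≤ Λ B ^ 2 := by
  have hm : MeasurableSet {y : ℝ≥0∞ | 2 ≤ y} := measurableSet_Ici
  have h1 : μ {ω | 2 ≤ N ω B} = (μ.map fun ω => N ω B) {y | 2 ≤ y} :=
    (Measure.map_apply (h.measurable_apply hB) hm).symm
  rw [h1, h.law_of_finite B hB hΛ, Measure.map_apply (measurable_of_countable _) hm]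
  have h2 : (fun k : ℕ => (k : ℝ≥0∞)) ⁻¹' {y | 2 ≤ y} = {k | 2 ≤ k} := by
    ext k
    simp only [mem_preimage, mem_ofPred_eq]
    exact_mod_cast Iff.rfl
  rw [h2]
  refine (poissonMeasure_two_le _).trans_eq ?_
  rw [ENNReal.coe_toNNReal hΛ]

/-- Cut `(-M, M]` into `2M(k+1)` cells of length `1/(k+1)`. A coincidence puts two points in one
cell, which has probability at most `2M(k+1) (c/(k+1))²`; this tends to `0`. -/
theorem SINRNetwork.IsPoissonProcess.measure_eq_eq_zero {u : ℕ → Ω → ℝ} {Λ : Measure ℝ}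
    (h : IsPoissonProcess (countingProcess u) Λ μ) {c : ℝ} (hc : 0 ≤ c)
    (hΛ : ∀ a b, a ≤ b → Λ (Ioc a b) ≤ ENNReal.ofReal (c * (b - a))) {n m : ℕ} (hnm : n ≠ m)
    (M : ℕ) : μ {ω | u n ω = u m ω ∧ u n ω ∈ Ioc (-M : ℝ) M} = 0 := by
  have key : ∀ k : ℕ, μ {ω | u n ω = u m ω ∧ u n ω ∈ Ioc (-M : ℝ) M} ≤
      ENNReal.ofReal (2 * M * c ^ 2 * (1 / ((k : ℝ) + 1))) := fun k => by
    have hk : (0 : ℝ) < k + 1 := by positivity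
    let C : ℕ → Set ℝ := fun i => Ioc (-M + i / (k + 1) : ℝ) (-M + (i + 1) / (k + 1))
    have hC : ∀ i, Λ (C i) ≤ ENNReal.ofReal (c * (1 / (k + 1))) := fun i => by
      refine (hΛ _ _ ?_).trans_eq ?_
      · gcongr
        linarith
      · congr 2
        ring
    have hsub : {ω | u n ω = u m ω ∧ u n ω ∈ Ioc (-M : ℝ) M} ⊆
        ⋃ i ∈ Finset.range (2 * M * (k + 1)), {ω | 2 ≤ countingProcess u ω (C i)} := by
      rintro ω ⟨he, h1, h2⟩
      let v : ℝ := (u n ω + M) * (k + 1)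
      have hv : 0 < v := mul_pos (by linarith) hk
      have hv' : v ≤ 2 * M * (k + 1) := mul_le_mul_of_nonneg_right (by linarith) hk.le
      -- The cells are open on the left and closed on the right, so the cell index is the ceiling
      -- minus one.
      obtain ⟨i, hi⟩ : ∃ i, ⌈v⌉₊ = i + 1 := Nat.exists_eq_succ_of_ne_zero (Nat.ceil_pos.2 hv).ne'
      have hi1 : (i : ℝ) < v := Nat.lt_ceil.1 (by omega)
      have hi2 : v ≤ i + 1 := by
        have := Nat.le_ceil v
        rw [hi] at this
        exact_mod_cast this
      have hmem : u n ω ∈ C i := by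
        constructor
        · have : (i : ℝ) / (k + 1) < u n ω + M := (div_lt_iff₀ hk).2 hi1
          linarith
        · have : u n ω + M ≤ ((i : ℝ) + 1) / (k + 1) := (le_div_iff₀ hk).2 hi2
          linarith
      refine mem_biUnion (x := i) ?_
        (two_le_countingProcess measurableSet_Ioc hnm hmem (he ▸ hmem))
      rw [Finset.mem_coe, Finset.mem_range]
      have : (i : ℝ) < 2 * M * (k + 1) := hi1.trans_le hv'
      exact_mod_cast this
    refine (measure_mono hsub).trans ((measure_biUnion_finset_le _ _).trans ?_)
    calc ∑ i ∈ Finset.range (2 * M * (k + 1)), μ {ω | 2 ≤ countingProcess u ω (C i)}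
        ≤ ∑ i ∈ Finset.range (2 * M * (k + 1)), ENNReal.ofReal (c * (1 / (k + 1))) ^ 2 := by
          refine Finset.sum_le_sum fun i _ => ?_
          refine (h.measure_two_le measurableSet_Ioc ?_).trans (pow_le_pow_left' (hC i) 2)
          exact ((hC i).trans_lt ENNReal.ofReal_lt_top).ne
      _ = ENNReal.ofReal (2 * M * c ^ 2 * (1 / ((k : ℝ) + 1))) := by
          rw [Finset.sum_const, Finset.card_range, nsmul_eq_mul,
            ← ENNReal.ofReal_pow (by positivity), ← ENNReal.ofReal_natCast,
            ← ENNReal.ofReal_mul (by positivity)]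
          congr 1
          push_cast
          field_simp
  have hlim : Tendsto (fun k : ℕ => ENNReal.ofReal (2 * M * c ^ 2 * (1 / ((k : ℝ) + 1)))) atTop
      (𝓝 0) := by
    rw [← ENNReal.ofReal_zero]
    refine ENNReal.tendsto_ofReal ?_
    simpa using tendsto_one_div_add_atTop_nhds_zero_nat.const_mul (2 * M * c ^ 2 : ℝ)
  exact le_antisymm (ge_of_tendsto' hlim key) zero_le

/-- A Poisson process on the line with a bounded density has no multiple points. -/
theorem SINRNetwork.IsPoissonProcess.ae_injective {u : ℕ → Ω → ℝ} {Λ : Measure ℝ}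
    (h : IsPoissonProcess (countingProcess u) Λ μ) {c : ℝ} (hc : 0 ≤ c)
    (hΛ : ∀ a b, a ≤ b → Λ (Ioc a b) ≤ ENNReal.ofReal (c * (b - a))) :
    ∀ᵐ ω ∂μ, Function.Injective fun n => u n ω := by
  have h1 : ∀ᵐ ω ∂μ, ∀ n m : ℕ, n ≠ m → ∀ M : ℕ,
      ¬(u n ω = u m ω ∧ u n ω ∈ Ioc (-M : ℝ) M) := by
    simp_rw [ae_all_iff]
    exact fun n m hnm M => measure_eq_zero_iff_ae_notMem.1 (h.measure_eq_eq_zero hc hΛ hnm M)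
  filter_upwards [h1] with ω hω n m he
  by_contra hnm
  obtain ⟨M, hM⟩ := exists_nat_gt |u n ω|
  exact hω n m hnm M ⟨he, (abs_lt.1 hM).1, (abs_lt.1 hM).2.le⟩

theorem SINRNetwork.IsPoissonProcess.ae_finite [IsProbabilityMeasure μ] {x : ℕ → Ω → E}
    {Λ : Measure E} (h : IsPoissonProcess (countingProcess x) Λ μ) {B : Set E}
    (hB : MeasurableSet B) (hΛ : Λ B ≠ ∞) : ∀ᵐ ω ∂μ, {n | x n ω ∈ B}.Finite := by
  have h1 := ae_lt_top (h.measurable_apply hB) (by rwa [h.lintegral_apply hB])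
  filter_upwards [h1] with ω hω
  rw [countingProcess_apply _ _ hB] at hω
  refine (ENNReal.finite_const_le_of_tsum_ne_top hω.ne one_ne_zero).subset fun n hn => ?_
  simp only [mem_ofPred_eq] at hn ⊢
  rw [indicator_of_mem hn]

/-- The map `φ` changes the coordinate so that the density becomes bounded. It need not be
injective: equal first coordinates have equal images, and the images are almost surely distinct. -/
theorem SINRNetwork.IsPoissonProcess.ae_orderable [IsProbabilityMeasure μ] {w : ℕ → Ω → ℝ × ℝ}
    {Λ : Measure (ℝ × ℝ)} (h : IsPoissonProcess (countingProcess w) Λ μ)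
    (hfin : ∀ s : ℝ, Λ (Iic s ×ˢ univ) ≠ ∞) {φ : ℝ → ℝ} (hφ : Measurable φ) {c : ℝ} (hc : 0 ≤ c)
    (hΛ : ∀ a b, a ≤ b → Λ ((fun p => φ p.1) ⁻¹' Ioc a b) ≤ ENNReal.ofReal (c * (b - a))) :
    ∀ᵐ ω ∂μ, Orderable fun n => w n ω := by
  have hg : Measurable fun p : ℝ × ℝ => φ p.1 := hφ.comp measurable_fst
  have h1 := h.map hg
  simp_rw [map_countingProcess _ _ hg] at h1
  have h2 := h1.ae_injective hc fun a b hab => by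
    rw [Measure.map_apply hg measurableSet_Ioc]
    exact hΛ a b hab
  have h3 : ∀ᵐ ω ∂μ, ∀ s : ℕ, {n | w n ω ∈ Iic (s : ℝ) ×ˢ (univ : Set ℝ)}.Finite :=
    ae_all_iff.2 fun s => h.ae_finite (measurableSet_Iic.prod MeasurableSet.univ) (hfin s)
  filter_upwards [h2, h3] with ω hω hω'
  refine ⟨fun n m hnm => hω (congrArg φ hnm), fun s => ?_⟩
  obtain ⟨k, hk⟩ := exists_nat_ge s
  refine (hω' k).subset fun n hn => ?_
  simp only [mem_ofPred_eq] at hn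
  exact ⟨hn.trans hk, mem_univ _⟩

end Simple

/-! ### Independent marks from a product intensity. -/

section OrderedMarks

variable {Ω Ω' E M : Type*} [MeasurableSpace Ω] [MeasurableSpace Ω'] [MeasurableSpace E]
  [MeasurableSpace M] {μ : Measure Ω} {μ' : Measure Ω'}

theorem SINRNetwork.IsPoissonProcess.comp [IsProbabilityMeasure μ'] [IsProbabilityMeasure μ]
    {N : Ω → Measure E} {Λ : Measure E} (h : IsPoissonProcess N Λ μ) {g : Ω' → Ω}
    (hg : MeasurePreserving g μ' μ) : IsPoissonProcess (fun ω => N (g ω)) Λ μ' := by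
  refine HasPoissonLaplace.isPoissonProcess (fun f hf => ?_) (h.measurable.comp hg.measurable)
  rw [← h.hasPoissonLaplace f hf]
  exact hg.lintegral_comp (measurable_lintegral_randomMeasure h.measurable hf).expNeg

theorem isIndependentMarking_of_map [IsProbabilityMeasure μ] {x : ℕ → Ω → E} {m : ℕ → Ω → M}
    {Q : Measure M} [IsProbabilityMeasure Q] (hx : ∀ n, Measurable (x n))
    (hm : ∀ n, Measurable (m n))
    (h : μ.map (fun ω => (fun n => x n ω, fun n => m n ω)) =
      (μ.map fun ω n => x n ω).prod (Measure.infinitePi fun _ => Q)) :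
    IsIndependentMarking x m Q μ := by
  have hx' : Measurable fun ω n => x n ω := measurable_pi_lambda _ hx
  have hm' : Measurable fun ω n => m n ω := measurable_pi_lambda _ hm
  have : IsProbabilityMeasure (μ.map fun ω n => x n ω) :=
    Measure.isProbabilityMeasure_map hx'.aemeasurable
  have h1 : μ.map (fun ω n => m n ω) = Measure.infinitePi fun _ => Q := by
    have := congrArg (Measure.map Prod.snd) h
    rwa [Measure.map_map measurable_snd (hx'.prodMk hm'), Measure.map_snd_prod, measure_univ,
      one_smul] at this
  have h2 : ∀ n, μ.map (m n) = Q := fun n => by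
    have := congrArg (Measure.map fun t : ℕ → M => t n) h1
    rwa [Measure.map_map (measurable_pi_apply n) hm', Measure.infinitePi_map_eval] at this
  refine ⟨hx, hm, h2, ?_, ?_⟩
  · rw [iIndepFun_iff_map_fun_eq_infinitePi_map hm, h1]
    simp_rw [h2]
  · rw [indepFun_iff_map_prod_eq_prod_map_map hx'.aemeasurable hm'.aemeasurable, h, h1]

theorem isIndependentMarking_prod [IsProbabilityMeasure μ] {x : ℕ → Ω → E} {Q : Measure M}
    [IsProbabilityMeasure Q] (hx : ∀ n, Measurable (x n)) :
    IsIndependentMarking (fun n (p : Ω × (ℕ → M)) => x n p.1) (fun n p => p.2 n) Q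
      (μ.prod (Measure.infinitePi fun _ => Q)) := by
  have hx' : Measurable fun ω n => x n ω := measurable_pi_lambda _ hx
  refine isIndependentMarking_of_map (fun n => (hx n).comp measurable_fst)
    (fun n => (measurable_pi_apply n).comp measurable_snd) ?_
  have h1 : (μ.prod (Measure.infinitePi fun _ => Q)).map
      (fun (p : Ω × (ℕ → M)) n => x n p.1) = μ.map fun ω n => x n ω := by
    have : (fun (p : Ω × (ℕ → M)) n => x n p.1) = (fun ω n => x n ω) ∘ Prod.fst := rfl
    rw [this, ← Measure.map_map hx' measurable_fst, Measure.map_fst_prod, measure_univ, one_smul]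
  rw [h1]
  have := Measure.map_prod_map μ (Measure.infinitePi fun _ : ℕ => Q) hx' measurable_id
  rw [Measure.map_id] at this
  exact this.symm

theorem orderable_of_mem_increasingSeq {z : ℕ → ℝ × ℝ} (hz : z ∈ increasingSeq) : Orderable z :=
  ⟨(strictMono_nat_of_lt_succ hz.1).injective, fun s =>
    (finite_lt_of_mem_increasingSeq hz (s + 1)).subset fun n hn => by
      simp only [mem_ofPred_eq] at hn ⊢
      linarith⟩

/-- Sorting preserves the counting measure, and an increasing sequence is determined by its counts.
-/
theorem sortSeq_eq_self {z : ℕ → ℝ × ℝ} (hz : z ∈ increasingSeq) : sortSeq z = z :=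
  injOn_basisCounts (orderable_of_mem_increasingSeq hz).sortSeq_mem hz
    (congrArg basisCounts (orderable_of_mem_increasingSeq hz).seqMeasure_sortSeq)

/-- A Poisson process of pairs whose intensity measure is a product is independently marked: the
marks, in the order of the points, are independent of the points. -/
theorem SINRNetwork.IsPoissonProcess.exists_isIndependentMarking [IsProbabilityMeasure μ]
    {w : ℕ → Ω → ℝ × ℝ} {ν F : Measure ℝ} [SFinite ν] [IsProbabilityMeasure F]
    (hw : ∀ n, Measurable (w n)) (h : IsPoissonProcess (countingProcess w) (ν.prod F) μ)
    (ho : ∀ᵐ ω ∂μ, Orderable fun n => w n ω) :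
    ∃ x m : ℕ → Ω → ℝ, IsIndependentMarking x m F μ ∧
      ∀ᵐ ω ∂μ, countingProcess w ω = countingProcess (fun n ω => (x n ω, m n ω)) ω := by
  have hsort : Measurable fun ω => sortSeq fun n => w n ω :=
    measurable_sortSeq.comp (measurable_pi_lambda _ hw)
  have hsortn : ∀ n, Measurable fun ω => sortSeq (fun n => w n ω) n := fun n =>
    (measurable_pi_apply n).comp hsort
  -- Sorting is essential: in the given enumeration a mark may depend on its point and have a law
  -- other than `F`.
  let x : ℕ → Ω → ℝ := fun n ω => (sortSeq (fun n => w n ω) n).1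
  let m : ℕ → Ω → ℝ := fun n ω => (sortSeq (fun n => w n ω) n).2
  have hx : ∀ n, Measurable (x n) := fun n => measurable_fst.comp (hsortn n)
  have hm : ∀ n, Measurable (m n) := fun n => measurable_snd.comp (hsortn n)
  have hcount : ∀ᵐ ω ∂μ, countingProcess w ω = countingProcess (fun n ω => (x n ω, m n ω)) ω :=
    ho.mono fun ω hω => hω.seqMeasure_sortSeq.symm
  refine ⟨x, m, isIndependentMarking_of_map hx hm ?_, hcount⟩
  -- Comparison model: keep the sorted points and attach fresh i.i.d. marks. By the marking theorem
  -- it is Poisson with the same intensity, hence has the same law as the original process.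
  let P := μ.prod (Measure.infinitePi fun _ : ℕ => F)
  let w' : ℕ → Ω × (ℕ → ℝ) → ℝ × ℝ := fun n p => (x n p.1, p.2 n)
  have hfst : MeasurePreserving Prod.fst P μ := measurePreserving_fst
  have hmark : IsIndependentMarking (fun n (p : Ω × (ℕ → ℝ)) => x n p.1) (fun n p => p.2 n) F P :=
    isIndependentMarking_prod hx
  have hground : IsPoissonProcess (countingProcess x) ν μ := by
    have h1 := h.map measurable_fst
    rw [Measure.map_fst_prod, measure_univ, one_smul] at h1
    refine h1.congr (measurable_countingProcess hx) ?_
    filter_upwards [hcount] with ω hω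
    rw [hω, map_countingProcess _ _ measurable_fst]
  have hP : IsPoissonProcess (countingProcess w') (ν.prod F) P :=
    hmark.isPoisson_marked (hground.comp hfst)
  have hw' : ∀ n, Measurable (w' n) := fun n =>
    (hmark.measurable_point n).prodMk (hmark.measurable_mark n)
  have hinc : ∀ᵐ p ∂P, (fun n => w' n p) ∈ increasingSeq :=
    (hfst.quasiMeasurePreserving.ae ho).mono fun p hp => ⟨hp.sortSeq_mem.1, hp.sortSeq_mem.2⟩
  -- Equality of process laws becomes equality of sorted-sequence laws. The model is already sorted,
  -- so the product law of its points and marks passes to `x` and `m`.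
  have hid := identDistrib_sortSeq hw hw' ho (hinc.mono fun p => orderable_of_mem_increasingSeq)
    (h.identDistrib hP)
  have hsplit : Measurable fun z : ℕ → ℝ × ℝ => (fun n => (z n).1, fun n => (z n).2) := by
    fun_prop
  have hlaw := (hid.comp hsplit).map_eq
  have hself : ∀ᵐ p ∂P, ((fun z : ℕ → ℝ × ℝ => (fun n => (z n).1, fun n => (z n).2)) ∘
      fun p => sortSeq fun n => w' n p) p = (fun n => x n p.1, fun n => p.2 n) :=
    hinc.mono fun p hp => by rw [Function.comp_apply, sortSeq_eq_self hp]
  rw [Measure.map_congr hself, hmark.map_points_marks] at hlaw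
  refine hlaw.trans ?_
  congr 1
  exact (Measure.map_map (measurable_pi_lambda _ hx) measurable_fst).symm.trans
    (by rw [hfst.map_eq])

end OrderedMarks

/-! ### Transfer of functionals that commute with relabelling. -/

section Equivariant

variable {Ω Ω' F : Type*} [MeasurableSpace Ω] [MeasurableSpace Ω'] [MeasurableSpace F]
  {μ : Measure Ω} {μ' : Measure Ω'} {w : ℕ → Ω → ℝ × ℝ} {w' : ℕ → Ω' → ℝ × ℝ}
  {G : (ℕ → ℝ × ℝ) → ℕ → F}

theorem identDistrib_countingProcess_of_equivariant
    (hw : ∀ n, Measurable (w n)) (hw' : ∀ n, Measurable (w' n))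
    (ho : ∀ᵐ ω ∂μ, Orderable fun n => w n ω) (ho' : ∀ᵐ ω ∂μ', Orderable fun n => w' n ω)
    (h : IdentDistrib (countingProcess w) (countingProcess w') μ μ')
    (hG : Measurable G) (hσ : ∀ z (σ : Equiv.Perm ℕ), G (z ∘ σ) = G z ∘ σ) :
    IdentDistrib (countingProcess fun n ω => G (fun n => w n ω) n)
      (countingProcess fun n ω => G (fun n => w' n ω) n) μ μ' :=
  identDistrib_of_perm_invariant hw hw' ho ho' h (measurable_seqMeasure.comp hG) fun z σ => by
    simp only [Function.comp_apply, hσ, seqMeasure_comp_perm]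

/-- A relabelling of the points permutes the injections `Fin k ↪ ℕ`, so the sum over distinct
indices is unchanged, and its expectation depends only on the law of the process. -/
theorem factorialMomentMeasure_eq_of_equivariant
    (hw : ∀ n, Measurable (w n)) (hw' : ∀ n, Measurable (w' n))
    (ho : ∀ᵐ ω ∂μ, Orderable fun n => w n ω) (ho' : ∀ᵐ ω ∂μ', Orderable fun n => w' n ω)
    (h : IdentDistrib (countingProcess w) (countingProcess w') μ μ')
    (hG : Measurable G) (hσ : ∀ z (σ : Equiv.Perm ℕ), G (z ∘ σ) = G z ∘ σ) (k : ℕ) :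
    factorialMomentMeasure (fun n ω => G (fun n => w n ω) n) k μ =
      factorialMomentMeasure (fun n ω => G (fun n => w' n ω) n) k μ' := by
  ext B hB
  have hz : ∀ n, Measurable fun ω => G (fun n => w n ω) n := fun n =>
    (measurable_pi_apply n).comp (hG.comp (measurable_pi_lambda _ hw))
  have hz' : ∀ n, Measurable fun ω => G (fun n => w' n ω) n := fun n =>
    (measurable_pi_apply n).comp (hG.comp (measurable_pi_lambda _ hw'))
  rw [factorialMomentMeasure_apply _ hz k μ B hB, factorialMomentMeasure_apply _ hz' k μ' B hB]
  have hc : Countable (Fin k ↪ ℕ) := DFunLike.coe_injective.countable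
  refine (identDistrib_of_perm_invariant hw hw' ho ho' h
    (H := fun z => ∑' i : Fin k ↪ ℕ, B.indicator (fun _ => (1 : ℝ≥0∞)) fun j => G z (i j))
    ?_ fun z σ => ?_).lintegral_eq
  · refine Measurable.tsum fun i => (measurable_const.indicator hB).comp ?_
    exact measurable_pi_lambda _ fun j => (measurable_pi_apply (i j)).comp hG
  · rw [hσ]
    exact (Equiv.embeddingCongr (Equiv.refl (Fin k)) σ).tsum_eq
      fun i : Fin k ↪ ℕ => B.indicator (fun _ => (1 : ℝ≥0∞)) fun j => G z (i j)

end Equivariant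

/-! ### SINR and STINR as equivariant functions of the losses. -/

section SINR

/-- The power received from the `n`-th point of a sequence of pairs (propagation loss, mark). -/
noncomputable def powerSeq (z : ℕ → ℝ × ℝ) (n : ℕ) : ℝ≥0∞ := (ENNReal.ofReal (z n).1)⁻¹

/-- The SINR of the `n`-th point of a sequence of pairs (propagation loss, mark). -/
noncomputable def sinrSeq (W γ : ℝ≥0) (z : ℕ → ℝ × ℝ) (n : ℕ) : ℝ≥0∞ :=
  powerSeq z n / (W + γ * ((∑' k, powerSeq z k) - powerSeq z n))

/-- The STINR of the `n`-th point of a sequence of pairs (propagation loss, mark). -/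
noncomputable def stinrSeq (W γ : ℝ≥0) (z : ℕ → ℝ × ℝ) (n : ℕ) : ℝ≥0∞ :=
  powerSeq z n / (W + γ * ∑' k, powerSeq z k)

theorem measurable_powerSeq (n : ℕ) : Measurable fun z => powerSeq z n := by
  unfold powerSeq
  fun_prop

theorem measurable_tsum_powerSeq : Measurable fun z => ∑' k, powerSeq z k :=
  Measurable.tsum measurable_powerSeq

theorem measurable_sinrSeq (W γ : ℝ≥0) : Measurable (sinrSeq W γ) :=
  measurable_pi_lambda _ fun n => (measurable_powerSeq n).div
    (measurable_const.add ((measurable_tsum_powerSeq.sub (measurable_powerSeq n)).const_mul _))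

theorem measurable_stinrSeq (W γ : ℝ≥0) : Measurable (stinrSeq W γ) :=
  measurable_pi_lambda _ fun n => (measurable_powerSeq n).div
    (measurable_const.add (measurable_tsum_powerSeq.const_mul _))

theorem tsum_powerSeq_comp (z : ℕ → ℝ × ℝ) (σ : Equiv.Perm ℕ) :
    ∑' k, powerSeq (z ∘ σ) k = ∑' k, powerSeq z k :=
  σ.tsum_eq (powerSeq z)

theorem sinrSeq_comp (W γ : ℝ≥0) (z : ℕ → ℝ × ℝ) (σ : Equiv.Perm ℕ) :
    sinrSeq W γ (z ∘ σ) = sinrSeq W γ z ∘ σ := by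
  funext n
  rw [sinrSeq, tsum_powerSeq_comp]
  rfl

theorem stinrSeq_comp (W γ : ℝ≥0) (z : ℕ → ℝ × ℝ) (σ : Equiv.Perm ℕ) :
    stinrSeq W γ (z ∘ σ) = stinrSeq W γ z ∘ σ := by
  funext n
  rw [stinrSeq, tsum_powerSeq_comp]
  rfl

theorem measurable_prodMk_snd {F : Type*} [MeasurableSpace F] {G : (ℕ → ℝ × ℝ) → ℕ → F}
    (hG : Measurable G) : Measurable fun (z : ℕ → ℝ × ℝ) n => (G z n, (z n).2) :=
  measurable_pi_lambda _ fun n => ((measurable_pi_apply n).comp hG).prodMk (by fun_prop)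

end SINR

/-! ### Intensity of the losses and the effect of random rescaling. -/

section Intensity

/-- The intensity measure of the propagation losses of a network with density `lam` and
`S = P = 1`. -/
noncomputable def lossIntensity (lam K β : ℝ) : Measure ℝ :=
  (ENNReal.ofReal lam • (volume : Measure Plane)).map fun x => pathLoss K β ‖x‖

theorem measurable_pathLoss (K β : ℝ) : Measurable fun x : Plane => pathLoss K β ‖x‖ := by
  unfold pathLoss
  exact (measurable_norm.const_mul K).pow_const β

instance (lam K β : ℝ) : SFinite (lossIntensity lam K β) := by
  unfold lossIntensity
  infer_instance

theorem volume_mul_norm_sq_le {K : ℝ} (hK : 0 < K) {s : ℝ} (hs : 0 ≤ s) :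
    (volume : Measure Plane) {x | (K * ‖x‖) ^ 2 ≤ s} = ENNReal.ofReal (Real.pi * s / K ^ 2) := by
  have h1 : {x : Plane | (K * ‖x‖) ^ 2 ≤ s} = Metric.closedBall 0 (√s / K) := by
    ext x
    rw [mem_ofPred_eq, mem_closedBall_zero_iff, le_div_iff₀ hK,
      Real.le_sqrt (by positivity) hs, mul_comm]
  rw [h1, EuclideanSpace.volume_closedBall_fin_two, ← ENNReal.ofReal_pow (by positivity),
    ← ENNReal.ofReal_mul (by positivity), div_pow, Real.sq_sqrt hs]
  congr 1
  ring

theorem lossIntensity_Iic {lam K β s : ℝ} (hlam : 0 ≤ lam) (hK : 0 < K) (hβ : 0 < β)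
    (hs : 0 ≤ s) :
    lossIntensity lam K β (Iic s) = ENNReal.ofReal (lam * Real.pi * s ^ (2 / β) / K ^ 2) := by
  have h1 : (fun x : Plane => pathLoss K β ‖x‖) ⁻¹' Iic s = {x | (K * ‖x‖) ^ 2 ≤ s ^ (2 / β)} := by
    ext x
    have h0 : 0 ≤ K * ‖x‖ := by positivity
    have h2 : (K * ‖x‖) ^ 2 = ((K * ‖x‖) ^ β) ^ (2 / β) := by
      rw [← Real.rpow_mul h0, mul_div_cancel₀ _ hβ.ne']
      norm_cast
    rw [mem_preimage, mem_Iic, mem_ofPred_eq, pathLoss, h2,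
      Real.rpow_le_rpow_iff (by positivity) hs (by positivity)]
  rw [lossIntensity, Measure.map_apply (measurable_pathLoss K β) measurableSet_Iic, h1,
    Measure.smul_apply, volume_mul_norm_sq_le hK (by positivity), smul_eq_mul,
    ← ENNReal.ofReal_mul hlam]
  congr 1
  ring

/-- In the coordinate `y^(2/β)` a loss becomes `(K|x|)²`, and the area of an annulus is linear in
the squared radii. For `β > 2` the density in `y` itself is unbounded near `0`. -/
theorem lossIntensity_preimage_Ioc_le {lam K β : ℝ} (hlam : 0 ≤ lam) (hK : 0 < K) (hβ : 0 < β)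
    {a b : ℝ} (hab : a ≤ b) :
    lossIntensity lam K β ((fun y => y ^ (2 / β)) ⁻¹' Ioc a b) ≤
      ENNReal.ofReal (lam * Real.pi / K ^ 2 * (b - a)) := by
  have h1 : (fun x : Plane => pathLoss K β ‖x‖) ⁻¹' ((fun y => y ^ (2 / β)) ⁻¹' Ioc a b) =
      {x | (K * ‖x‖) ^ 2 ≤ b} \ {x | (K * ‖x‖) ^ 2 ≤ a} := by
    ext x
    have h0 : 0 ≤ K * ‖x‖ := by positivity
    have h2 : ((K * ‖x‖) ^ β) ^ (2 / β) = (K * ‖x‖) ^ 2 := by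
      rw [← Real.rpow_mul h0, mul_div_cancel₀ _ hβ.ne']
      norm_cast
    simp only [mem_preimage, pathLoss, h2, mem_Ioc, Set.mem_sdiff, mem_ofPred_eq, not_le]
    exact and_comm
  have hm : ∀ s : ℝ, MeasurableSet {x : Plane | (K * ‖x‖) ^ 2 ≤ s} := fun s =>
    measurableSet_le (by fun_prop) measurable_const
  have hvol : (volume : Measure Plane) ({x | (K * ‖x‖) ^ 2 ≤ b} \ {x | (K * ‖x‖) ^ 2 ≤ a}) ≤
      ENNReal.ofReal (Real.pi * (b - a) / K ^ 2) := by
    rcases le_or_gt 0 a with ha | ha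
    · rw [measure_sdiff (fun x hx => ?_) (hm a).nullMeasurableSet,
        volume_mul_norm_sq_le hK (ha.trans hab), volume_mul_norm_sq_le hK ha,
        ← ENNReal.ofReal_sub _ (by positivity)]
      · refine le_of_eq (congrArg _ ?_)
        ring
      · rw [volume_mul_norm_sq_le hK ha]
        exact ENNReal.ofReal_ne_top
      · exact le_trans (show (K * ‖x‖) ^ 2 ≤ a from hx) hab
    -- For negative `a` the removed disc is empty, and `b ≤ b - a` leaves room in the bound.
    · refine (measure_mono sdiff_subset).trans ?_
      rcases le_or_gt 0 b with hb | hb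
      · rw [volume_mul_norm_sq_le hK hb]
        refine ENNReal.ofReal_le_ofReal ?_
        gcongr
        linarith
      · have : {x : Plane | (K * ‖x‖) ^ 2 ≤ b} = ∅ :=
          eq_empty_of_forall_notMem fun x hx =>
            (hb.trans_le (sq_nonneg (K * ‖x‖))).not_ge hx
        rw [this, measure_empty]
        exact zero_le
  have hφ : Measurable fun y : ℝ => y ^ (2 / β) := measurable_id.pow_const _
  rw [lossIntensity, Measure.map_apply (measurable_pathLoss K β) (hφ measurableSet_Ioc), h1,
    Measure.smul_apply, smul_eq_mul]
  refine (mul_le_mul_right hvol _).trans_eq ?_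
  rw [← ENNReal.ofReal_mul hlam]
  congr 1
  ring

/-- The propagation losses of a network with independent thresholds can be ordered. -/
theorem ae_orderable_of_lossIntensity {Ω : Type*} [MeasurableSpace Ω] {μ : Measure Ω}
    [IsProbabilityMeasure μ] {w : ℕ → Ω → ℝ × ℝ} {lam K β : ℝ} (hlam : 0 ≤ lam) (hK : 0 < K)
    (hβ : 0 < β) {F : Measure ℝ} [IsProbabilityMeasure F]
    (h : IsPoissonProcess (countingProcess w) ((lossIntensity lam K β).prod F) μ) :
    ∀ᵐ ω ∂μ, Orderable fun n => w n ω := by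
  have hφ : Measurable fun y : ℝ => y ^ (2 / β) := measurable_id.pow_const _
  refine h.ae_orderable (fun s => ?_) hφ (c := lam * Real.pi / K ^ 2) (by positivity)
    fun a b hab => ?_
  · rw [Measure.prod_prod, measure_univ, mul_one]
    refine ((measure_mono (Iic_subset_Iic.2 (le_max_left s 0))).trans_lt ?_).ne
    rw [lossIntensity_Iic hlam hK hβ (le_max_right s 0)]
    exact ENNReal.ofReal_lt_top
  · have : (fun p : ℝ × ℝ => p.1 ^ (2 / β)) ⁻¹' Ioc a b =
        ((fun y => y ^ (2 / β)) ⁻¹' Ioc a b) ×ˢ univ := by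
      ext p
      simp
    rw [this, Measure.prod_prod, measure_univ, mul_one]
    exact lossIntensity_preimage_Ioc_le hlam hK hβ hab

/-- Rescaling the points of a marked homogeneous process by their marks. -/
theorem map_smul_prod {β : ℝ} (lam : ℝ) {Q : Measure (ℝ × ℝ × ℝ)} [SFinite Q]
    (hpos : ∀ᵐ q ∂Q, 0 < q.2.1 * q.1) {κ : Measure ℝ} [SigmaFinite κ]
    (hκ : (Q.withDensity fun q => ENNReal.ofReal ((q.2.1 * q.1) ^ (2 / β))).map
      (fun q => q.2.2) = κ) :
    ((ENNReal.ofReal lam • (volume : Measure Plane)).prod Q).map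
      (fun p => (((p.2.2.1 * p.2.1) ^ (1 / β))⁻¹ • p.1, p.2.2.2)) =
      (ENNReal.ofReal lam • (volume : Measure Plane)).prod κ := by
  have hg : Measurable fun p : Plane × ℝ × ℝ × ℝ =>
      (((p.2.2.1 * p.2.1) ^ (1 / β))⁻¹ • p.1, p.2.2.2) := by
    have h1 : Measurable fun p : Plane × ℝ × ℝ × ℝ => ((p.2.2.1 * p.2.1) ^ (1 / β))⁻¹ :=
      (Measurable.pow_const (by fun_prop) _).inv
    exact (h1.smul measurable_fst).prodMk (by fun_prop)
  have hsf : SigmaFinite (ENNReal.ofReal lam • (volume : Measure Plane)) := by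
    rw [ENNReal.ofReal]
    exact inferInstanceAs (SigmaFinite (lam.toNNReal • (volume : Measure Plane)))
  refine (Measure.prod_eq fun A B hA hB => ?_).symm
  have hB' : MeasurableSet ((fun q : ℝ × ℝ × ℝ => q.2.2) ⁻¹' B) := (by fun_prop : Measurable
    fun q : ℝ × ℝ × ℝ => q.2.2) hB
  rw [Measure.map_apply hg (hA.prod hB), Measure.prod_apply_symm (hg (hA.prod hB)), ← hκ,
    Measure.map_apply (by fun_prop) hB, withDensity_apply _ hB', ← lintegral_indicator hB',
    ← lintegral_const_mul]
  swap
  · refine Measurable.indicator (Measurable.ennreal_ofReal (Measurable.pow_const ?_ _)) hB'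
    fun_prop
  refine lintegral_congr_ae ?_
  filter_upwards [hpos] with q hq
  by_cases hqB : q.2.2 ∈ B
  · have h1 : (fun x : Plane => (x, q)) ⁻¹' ((fun p : Plane × ℝ × ℝ × ℝ =>
        (((p.2.2.1 * p.2.1) ^ (1 / β))⁻¹ • p.1, p.2.2.2)) ⁻¹' A ×ˢ B) =
        (fun x : Plane => ((q.2.1 * q.1) ^ (1 / β))⁻¹ • x) ⁻¹' A := by
      ext x
      simp [hqB]
    have hc : ((q.2.1 * q.1) ^ (1 / β))⁻¹ ≠ 0 := by positivity
    rw [h1, indicator_of_mem (show q ∈ (fun q : ℝ × ℝ × ℝ => q.2.2) ⁻¹' B from hqB),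
      Measure.smul_apply, Measure.smul_apply, smul_eq_mul, smul_eq_mul,
      Measure.addHaar_preimage_smul _ hc, mul_assoc, mul_comm (volume A)]
    congr 3
    -- Dimension two squares the scaling factor: `((PS)^(1/β))² = (PS)^(2/β)` is the weight in the
    -- biased law.
    rw [finrank_euclideanSpace_fin, inv_pow, inv_inv, abs_of_nonneg (by positivity),
      ← Real.rpow_natCast, ← Real.rpow_mul hq.le]
    congr 1
    push_cast
    ring
  · have h1 : (fun x : Plane => (x, q)) ⁻¹' ((fun p : Plane × ℝ × ℝ × ℝ =>
        (((p.2.2.1 * p.2.1) ^ (1 / β))⁻¹ • p.1, p.2.2.2)) ⁻¹' A ×ˢ B) = ∅ := by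
      ext x
      simp [hqB]
    rw [h1, indicator_of_notMem (show q ∉ (fun q : ℝ × ℝ × ℝ => q.2.2) ⁻¹' B from hqB)]
    simp

end Intensity

/-! ### Networks: rescaling, the biased threshold law and equivalence. -/

section Networks

variable {Ω Ω₀ : Type*} [MeasurableSpace Ω] [MeasurableSpace Ω₀] {μ : Measure Ω} {μ₀ : Measure Ω₀}

theorem SINRNetwork.IsIndependentMarking.map_mark {E M M' : Type*} [MeasurableSpace E]
    [MeasurableSpace M] [MeasurableSpace M'] {x : ℕ → Ω → E} {m : ℕ → Ω → M} {Q : Measure M}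
    (h : IsIndependentMarking x m Q μ) {g : M → M'} (hg : Measurable g) :
    IsIndependentMarking x (fun n ω => g (m n ω)) (Q.map g) μ where
  measurable_point := h.measurable_point
  measurable_mark n := hg.comp (h.measurable_mark n)
  law_mark n := by
    rw [← h.law_mark n, Measure.map_map hg (h.measurable_mark n)]
    rfl
  indep_marks := h.indep_marks.comp (fun _ => g) fun _ => hg
  indep_points_marks := h.indep_points_marks.comp measurable_id
    (measurable_pi_lambda _ fun n => hg.comp (measurable_pi_apply n) :
      Measurable fun (t : ℕ → M) n => g (t n))

theorem SINRNetwork.IsNetwork.measurable_loss_threshold {lam : ℝ} {X : ℕ → Ω → Plane}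
    {S P T : ℕ → Ω → ℝ} {Q : Measure (ℝ × ℝ × ℝ)} (h : IsNetwork lam X S P T Q μ) (K β : ℝ) (n : ℕ) :
    Measurable fun ω => (loss K β X S P n ω, T n ω) := by
  have hm := h.marks.measurable_mark n
  have hS : Measurable (S n) := measurable_fst.comp hm
  have hP : Measurable (P n) := measurable_fst.comp (measurable_snd.comp hm)
  have hT : Measurable (T n) := measurable_snd.comp (measurable_snd.comp hm)
  exact (((measurable_pathLoss K β).comp (h.marks.measurable_point n)).div (hP.mul hS)).prodMk hT

theorem pathLoss_norm_smul {K β : ℝ} (hK : 0 < K) (hβ : 0 < β) {c : ℝ} (hc : 0 < c) (x : Plane) :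
    pathLoss K β ‖(c ^ (1 / β))⁻¹ • x‖ = pathLoss K β ‖x‖ / c := by
  rw [norm_smul, norm_inv, Real.norm_of_nonneg (by positivity), pathLoss, pathLoss,
    mul_left_comm, Real.mul_rpow (by positivity) (by positivity), Real.inv_rpow (by positivity),
    ← Real.rpow_mul hc.le, one_div_mul_cancel hβ.ne', Real.rpow_one, div_eq_inv_mul]

theorem isPoissonProcess_pathLoss {lam : ℝ} {F : Measure ℝ} [IsProbabilityMeasure F]
    {Z : ℕ → Ω → Plane} {T : ℕ → Ω → ℝ}
    (h : IsPoissonProcess (countingProcess fun n ω => (Z n ω, T n ω))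
      ((ENNReal.ofReal lam • volume).prod F) μ) (K β : ℝ) :
    IsPoissonProcess (countingProcess fun n ω => (pathLoss K β ‖Z n ω‖, T n ω))
      ((lossIntensity lam K β).prod F) μ := by
  have hg : Measurable (Prod.map (fun x : Plane => pathLoss K β ‖x‖) (id : ℝ → ℝ)) :=
    (measurable_pathLoss K β).prodMap measurable_id
  have h1 := h.map hg
  simp_rw [map_countingProcess _ _ hg] at h1
  rwa [← Measure.map_prod_map _ _ (measurable_pathLoss K β) measurable_id, Measure.map_id] at h1

/-- Rescaling the base stations yields a homogeneous network with independent thresholds. -/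
theorem SINRNetwork.IsNetwork.isPoissonProcess_rescaled [IsProbabilityMeasure μ] {lam β : ℝ}
    {X : ℕ → Ω → Plane} {S P T : ℕ → Ω → ℝ} {Q : Measure (ℝ × ℝ × ℝ)}
    (h : IsNetwork lam X S P T Q μ) (hpos : ∀ᵐ q ∂Q, 0 < q.2.1 * q.1) {κ : Measure ℝ}
    [SigmaFinite κ]
    (hκ : (Q.withDensity fun q => ENNReal.ofReal ((q.2.1 * q.1) ^ (2 / β))).map
      (fun q => q.2.2) = κ) :
    IsPoissonProcess
      (countingProcess fun n ω => (((P n ω * S n ω) ^ (1 / β))⁻¹ • X n ω, T n ω))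
      ((ENNReal.ofReal lam • volume).prod κ) μ := by
  have := h.marks.isProbabilityMeasure
  have hg : Measurable fun p : Plane × ℝ × ℝ × ℝ =>
      (((p.2.2.1 * p.2.1) ^ (1 / β))⁻¹ • p.1, p.2.2.2) := by
    have h1 : Measurable fun p : Plane × ℝ × ℝ × ℝ => ((p.2.2.1 * p.2.1) ^ (1 / β))⁻¹ :=
      (Measurable.pow_const (by fun_prop) _).inv
    exact (h1.smul measurable_fst).prodMk (by fun_prop)
  have h1 := (h.marks.isPoisson_marked h.poisson).map hg
  simp_rw [map_countingProcess _ _ hg] at h1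
  rwa [map_smul_prod lam hpos hκ] at h1

theorem SINRNetwork.IsNetwork.ae_pos {lam : ℝ} {X : ℕ → Ω → Plane} {S P T : ℕ → Ω → ℝ}
    {Q : Measure (ℝ × ℝ × ℝ)} (h : IsNetwork lam X S P T Q μ)
    (hpos : ∀ᵐ q ∂Q, 0 < q.2.1 * q.1) : ∀ᵐ ω ∂μ, ∀ n, 0 < P n ω * S n ω := by
  rw [ae_all_iff]
  intro n
  rw [← h.marks.law_mark n] at hpos
  exact ae_of_ae_map (h.marks.measurable_mark n).aemeasurable hpos

/-- Almost surely every `P n * S n` is positive, and then each loss is the plain path loss at the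
rescaled station, so the rescaled process is simply mapped through the path loss. -/
theorem SINRNetwork.IsNetwork.isPoissonProcess_markedPropagation [IsProbabilityMeasure μ]
    {lam lam' K β : ℝ} (hK : 0 < K) (hβ : 0 < β)
    {X : ℕ → Ω → Plane} {S P T : ℕ → Ω → ℝ} {Q : Measure (ℝ × ℝ × ℝ)}
    (h : IsNetwork lam X S P T Q μ) (hpos : ∀ᵐ q ∂Q, 0 < q.2.1 * q.1) {F : Measure ℝ}
    [IsProbabilityMeasure F]
    (hres : IsPoissonProcess
      (countingProcess fun n ω => (((P n ω * S n ω) ^ (1 / β))⁻¹ • X n ω, T n ω))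
      ((ENNReal.ofReal lam' • volume).prod F) μ) :
    IsPoissonProcess (markedPropagation K β X S P T) ((lossIntensity lam' K β).prod F) μ := by
  refine (isPoissonProcess_pathLoss hres K β).congr
    (measurable_countingProcess (h.measurable_loss_threshold K β)) ?_
  filter_upwards [h.ae_pos hpos] with ω hω
  refine congrArg Measure.sum (funext fun n => ?_)
  beta_reduce
  rw [pathLoss_norm_smul hK hβ (hω n)]
  rfl

theorem SINRNetwork.IsNetwork.isPoissonProcess_markedPropagation_one [IsProbabilityMeasure μ]
    {lam K β : ℝ} {X : ℕ → Ω → Plane} {T : ℕ → Ω → ℝ} {F : Measure ℝ} [IsProbabilityMeasure F]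
    (h : IsNetwork lam X (fun _ _ => 1) (fun _ _ => 1) T (F.map fun t => (1, 1, t)) μ) :
    IsPoissonProcess (markedPropagation K β X (fun _ _ => 1) (fun _ _ => 1) T)
      ((lossIntensity lam K β).prod F) μ := by
  have hsnd : Measurable fun q : ℝ × ℝ × ℝ => q.2.2 := by fun_prop
  have hmk : Measurable fun t : ℝ => ((1 : ℝ), (1 : ℝ), t) := by fun_prop
  have h1 := h.marks.map_mark hsnd
  rw [Measure.map_map hsnd hmk] at h1
  have h2 : IsIndependentMarking X T F μ := by
    have := h1
    rwa [show (fun q : ℝ × ℝ × ℝ => q.2.2) ∘ (fun t : ℝ => ((1 : ℝ), (1 : ℝ), t)) = id from rfl,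
      Measure.map_id] at this
  have h3 := isPoissonProcess_pathLoss (h2.isPoisson_marked h.poisson) K β
  have h4 : loss K β X (fun _ _ => 1) (fun _ _ => 1) = fun n ω => pathLoss K β ‖X n ω‖ := by
    funext n ω
    simp [loss]
  rwa [markedPropagation, h4]

theorem isIndependentlyMarkedPoisson_of_isPoissonProcess [IsProbabilityMeasure μ]
    {w : ℕ → Ω → ℝ × ℝ} {ν F : Measure ℝ} [SFinite ν] [IsProbabilityMeasure F]
    (hw : ∀ n, Measurable (w n)) (h : IsPoissonProcess (countingProcess w) (ν.prod F) μ)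
    (ho : ∀ᵐ ω ∂μ, Orderable fun n => w n ω) :
    IsIndependentlyMarkedPoisson (countingProcess w) (ν.prod F) F μ :=
  ⟨h.map measurable_fst, h.exists_isIndependentMarking hw ho, fun _ hB => h.lintegral_apply hB⟩

/-- The law of `T` under the probability measure with density proportional to
`(P S) ^ (2 / β)`. -/
noncomputable def biasedThreshold (β : ℝ) (S P T : Ω₀ → ℝ) (μ₀ : Measure Ω₀) : Measure ℝ :=
  (ENNReal.ofReal (propMoment β S P μ₀))⁻¹ •
    (μ₀.withDensity fun ω => ENNReal.ofReal ((P ω * S ω) ^ (2 / β))).map T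

section BiasedThreshold

variable {β : ℝ} {S P T : Ω₀ → ℝ}

theorem propMoment_pos [IsProbabilityMeasure μ₀] (hpos : ∀ᵐ ω ∂μ₀, 0 < P ω * S ω)
    (hmoment : Integrable (fun ω => (P ω * S ω) ^ (2 / β)) μ₀) : 0 < propMoment β S P μ₀ := by
  refine (integral_pos_iff_support_of_nonneg_ae ?_ hmoment).2 ?_
  · exact hpos.mono fun ω hω => Real.rpow_nonneg hω.le _
  · rw [pos_iff_ne_zero]
    intro h0
    have h1 : ∀ᵐ ω ∂μ₀, ω ∉ Function.support fun ω => (P ω * S ω) ^ (2 / β) :=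
      measure_eq_zero_iff_ae_notMem.1 h0
    obtain ⟨ω, h2, h3⟩ := (h1.and hpos).exists
    exact h2 (Real.rpow_pos_of_pos h3 _).ne'

theorem map_withDensity_Iic [IsProbabilityMeasure μ₀] (hT : Measurable T)
    (hpos : ∀ᵐ ω ∂μ₀, 0 < P ω * S ω)
    (hmoment : Integrable (fun ω => (P ω * S ω) ^ (2 / β)) μ₀) (t : ℝ) :
    (μ₀.withDensity fun ω => ENNReal.ofReal ((P ω * S ω) ^ (2 / β))).map T (Iic t) =
      ENNReal.ofReal (propMomentUpTo β S P T t μ₀) := by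
  have hA : MeasurableSet {ω | T ω ≤ t} := hT measurableSet_Iic
  have h1 : propMomentUpTo β S P T t μ₀ = ∫ ω in {ω | T ω ≤ t}, (P ω * S ω) ^ (2 / β) ∂μ₀ := by
    rw [propMomentUpTo, ← integral_indicator hA]
    congr 1
    funext ω
    by_cases h : ω ∈ {ω | T ω ≤ t} <;> simp [h]
  rw [h1, ofReal_integral_eq_lintegral_ofReal hmoment.integrableOn, Measure.map_apply hT
    measurableSet_Iic, withDensity_apply _ (hT measurableSet_Iic)]
  · rfl
  · exact ae_restrict_of_ae (hpos.mono fun ω hω => Real.rpow_nonneg hω.le _)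

theorem map_withDensity_univ [IsProbabilityMeasure μ₀] (hT : Measurable T)
    (hpos : ∀ᵐ ω ∂μ₀, 0 < P ω * S ω)
    (hmoment : Integrable (fun ω => (P ω * S ω) ^ (2 / β)) μ₀) :
    (μ₀.withDensity fun ω => ENNReal.ofReal ((P ω * S ω) ^ (2 / β))).map T univ =
      ENNReal.ofReal (propMoment β S P μ₀) := by
  rw [propMoment, ofReal_integral_eq_lintegral_ofReal hmoment
      (hpos.mono fun ω hω => Real.rpow_nonneg hω.le _), Measure.map_apply hT MeasurableSet.univ,
    preimage_univ, withDensity_apply _ MeasurableSet.univ, setLIntegral_univ]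

theorem isProbabilityMeasure_biasedThreshold [IsProbabilityMeasure μ₀] (hT : Measurable T)
    (hpos : ∀ᵐ ω ∂μ₀, 0 < P ω * S ω)
    (hmoment : Integrable (fun ω => (P ω * S ω) ^ (2 / β)) μ₀) :
    IsProbabilityMeasure (biasedThreshold β S P T μ₀) := by
  refine ⟨?_⟩
  rw [biasedThreshold, Measure.smul_apply, map_withDensity_univ hT hpos hmoment, smul_eq_mul]
  exact ENNReal.inv_mul_cancel (ENNReal.ofReal_pos.2 (propMoment_pos hpos hmoment)).ne'
    ENNReal.ofReal_ne_top

theorem propMomentUpTo_nonneg (hpos : ∀ᵐ ω ∂μ₀, 0 < P ω * S ω) (t : ℝ) :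
    0 ≤ propMomentUpTo β S P T t μ₀ :=
  integral_nonneg_of_ae <| hpos.mono fun _ hω =>
    mul_nonneg (Real.rpow_nonneg hω.le _) (indicator_nonneg (fun _ _ => zero_le_one) _)

theorem biasedThreshold_Iic [IsProbabilityMeasure μ₀] (hT : Measurable T)
    (hpos : ∀ᵐ ω ∂μ₀, 0 < P ω * S ω)
    (hmoment : Integrable (fun ω => (P ω * S ω) ^ (2 / β)) μ₀) (t : ℝ) :
    biasedThreshold β S P T μ₀ (Iic t) =
      ENNReal.ofReal (propMomentUpTo β S P T t μ₀ / propMoment β S P μ₀) := by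
  have h0 := propMoment_pos hpos hmoment
  rw [biasedThreshold, Measure.smul_apply, map_withDensity_Iic hT hpos hmoment, smul_eq_mul,
    ENNReal.ofReal_div_of_pos h0, ENNReal.div_eq_inv_mul]

theorem ofReal_propMoment_smul_biasedThreshold [IsProbabilityMeasure μ₀]
    (hpos : ∀ᵐ ω ∂μ₀, 0 < P ω * S ω)
    (hmoment : Integrable (fun ω => (P ω * S ω) ^ (2 / β)) μ₀) :
    ENNReal.ofReal (propMoment β S P μ₀) • biasedThreshold β S P T μ₀ =
      (μ₀.withDensity fun ω => ENNReal.ofReal ((P ω * S ω) ^ (2 / β))).map T := by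
  rw [biasedThreshold, smul_smul, ENNReal.mul_inv_cancel
    (ENNReal.ofReal_pos.2 (propMoment_pos hpos hmoment)).ne' ENNReal.ofReal_ne_top, one_smul]

/-- Passes from the law of the mark vector, used by the network, to the generic vector on `Ω₀`, used
in the moments. -/
theorem map_withDensity_threshold (hS : Measurable S) (hP : Measurable P) (hT : Measurable T) :
    ((μ₀.map fun ω => (S ω, P ω, T ω)).withDensity
        fun q => ENNReal.ofReal ((q.2.1 * q.1) ^ (2 / β))).map (fun q => q.2.2) =
      (μ₀.withDensity fun ω => ENNReal.ofReal ((P ω * S ω) ^ (2 / β))).map T := by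
  have hV : Measurable fun ω => (S ω, P ω, T ω) := hS.prodMk (hP.prodMk hT)
  have hd : Measurable fun q : ℝ × ℝ × ℝ => ENNReal.ofReal ((q.2.1 * q.1) ^ (2 / β)) :=
    (Measurable.pow_const (by fun_prop) _).ennreal_ofReal
  have hsnd : Measurable fun q : ℝ × ℝ × ℝ => q.2.2 := by fun_prop
  ext B hB
  rw [Measure.map_apply hsnd hB, Measure.map_apply hT hB, withDensity_apply _ (hsnd hB),
    withDensity_apply _ (hT hB), setLIntegral_map (hsnd hB) hd hV]
  rfl

end BiasedThreshold

/-- Networks with the same distribution of the marked propagation process induce the same SINR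
and STINR processes. -/
theorem sinr_stinr_of_identDistrib {Ω' : Type*} [MeasurableSpace Ω'] {μ' : Measure Ω'} {K β : ℝ}
    {X : ℕ → Ω → Plane} {S P T : ℕ → Ω → ℝ} {X' : ℕ → Ω' → Plane} {S' P' T' : ℕ → Ω' → ℝ}
    (hw : ∀ n, Measurable fun ω => (loss K β X S P n ω, T n ω))
    (hw' : ∀ n, Measurable fun ω => (loss K β X' S' P' n ω, T' n ω))
    (ho : ∀ᵐ ω ∂μ, Orderable fun n => (loss K β X S P n ω, T n ω))
    (ho' : ∀ᵐ ω ∂μ', Orderable fun n => (loss K β X' S' P' n ω, T' n ω))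
    (h : IdentDistrib (markedPropagation K β X S P T) (markedPropagation K β X' S' P' T') μ μ')
    (W γ : ℝ≥0) :
    EqualInLaw (countingProcess fun n ω => (sinr W γ K β X S P n ω, T n ω)) μ
        (countingProcess fun n ω => (sinr W γ K β X' S' P' n ω, T' n ω)) μ' ∧
      EqualInLaw (countingProcess fun n ω => (stinr W γ K β X S P n ω, T n ω)) μ
        (countingProcess fun n ω => (stinr W γ K β X' S' P' n ω, T' n ω)) μ' ∧
      ∀ n : ℕ,
        factorialMomentMeasure (sinr W γ K β X S P) n μ =
          factorialMomentMeasure (sinr W γ K β X' S' P') n μ' ∧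
        factorialMomentMeasure (stinr W γ K β X S P) n μ =
          factorialMomentMeasure (stinr W γ K β X' S' P') n μ' := by
  have e1 : ∀ n ω, sinr W γ K β X S P n ω =
      sinrSeq W γ (fun n => (loss K β X S P n ω, T n ω)) n := fun _ _ => rfl
  have e1' : ∀ n ω, sinr W γ K β X' S' P' n ω =
      sinrSeq W γ (fun n => (loss K β X' S' P' n ω, T' n ω)) n := fun _ _ => rfl
  have e2 : ∀ n ω, stinr W γ K β X S P n ω =
      stinrSeq W γ (fun n => (loss K β X S P n ω, T n ω)) n := fun _ _ => rfl
  have e2' : ∀ n ω, stinr W γ K β X' S' P' n ω =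
      stinrSeq W γ (fun n => (loss K β X' S' P' n ω, T' n ω)) n := fun _ _ => rfl
  refine ⟨?_, ?_, fun n => ⟨?_, ?_⟩⟩
  · simp_rw [e1, e1']
    exact identDistrib_countingProcess_of_equivariant hw hw' ho ho' h
      (G := fun z n => (sinrSeq W γ z n, (z n).2)) (measurable_prodMk_snd (measurable_sinrSeq W γ))
      fun z σ => by rw [sinrSeq_comp]; rfl
  · simp_rw [e2, e2']
    exact identDistrib_countingProcess_of_equivariant hw hw' ho ho' h
      (G := fun z n => (stinrSeq W γ z n, (z n).2))
      (measurable_prodMk_snd (measurable_stinrSeq W γ)) fun z σ => by rw [stinrSeq_comp]; rfl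
  · rw [funext₂ e1, funext₂ e1']
    exact factorialMomentMeasure_eq_of_equivariant hw hw' ho ho' h
      (measurable_sinrSeq W γ) (sinrSeq_comp W γ) n
  · rw [funext₂ e2, funext₂ e2']
    exact factorialMomentMeasure_eq_of_equivariant hw hw' ho ho' h
      (measurable_stinrSeq W γ) (stinrSeq_comp W γ) n

end Networks

theorem mainTheorem9
    {Ω : Type u} [MeasurableSpace Ω] (μ : Measure Ω) [IsProbabilityMeasure μ]
    {Ω₀ : Type v} [MeasurableSpace Ω₀] (μ₀ : Measure Ω₀) [IsProbabilityMeasure μ₀]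
    (lam K β : ℝ) (hlam : 0 < lam) (hK : 0 < K) (hβ : 2 < β)
    -- the generic mark `(S, P, T)`
    (S P T : Ω₀ → ℝ) (hS : Measurable S) (hP : Measurable P) (hT : Measurable T)
    (hpos : ∀ᵐ ω ∂μ₀, 0 < S ω ∧ 0 < P ω ∧ 0 < T ω)
    (hmoment : Integrable (fun ω => (P ω * S ω) ^ (2 / β)) μ₀)
    -- the network
    (X : ℕ → Ω → Plane) (SX PX TX : ℕ → Ω → ℝ)
    (hnet : IsNetwork lam X SX PX TX (μ₀.map fun ω => (S ω, P ω, T ω)) μ) :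
    -- the distribution of `T*`
    ∃ F : Measure ℝ, IsProbabilityMeasure F ∧
      (∀ t : ℝ, F.real (Iic t) = propMomentUpTo β S P T t μ₀ / propMoment β S P μ₀) ∧
      -- the marked propagation process is an independently marked Poisson process
      (∃ Λ : Measure (ℝ × ℝ),
        (∀ s t : ℝ, 0 ≤ s → Λ (Iic s ×ˢ Iic t) =
          ENNReal.ofReal (lam * Real.pi * s ^ (2 / β) / K ^ 2 * propMomentUpTo β S P T t μ₀)) ∧
        IsPoissonProcess (markedPropagation K β X SX PX TX) Λ μ ∧
        IsIndependentlyMarkedPoisson (markedPropagation K β X SX PX TX) Λ F μ) ∧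
      -- the two forms of `λ*`
      lam * propMoment β S P μ₀ = propConstant lam K β S P μ₀ * K ^ 2 / Real.pi ∧
      -- there is a stochastically equivalent network with `S = P = 1`, density `λ*`, marks `T*`
      (∃ (Ω' : Type u) (_ : MeasurableSpace Ω') (μ' : Measure Ω') (X' : ℕ → Ω' → Plane)
        (T' : ℕ → Ω' → ℝ), IsProbabilityMeasure μ' ∧
        IsNetwork (lam * propMoment β S P μ₀) X' (fun _ _ => 1) (fun _ _ => 1) T'
          (F.map fun t => (1, 1, t)) μ' ∧
        EqualInLaw (markedPropagation K β X SX PX TX) μ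
          (markedPropagation K β X' (fun _ _ => 1) (fun _ _ => 1) T') μ') ∧
      -- every such network is equivalent, and induces the same SINR and STINR processes
      (∀ (Ω' : Type w) [MeasurableSpace Ω'] (μ' : Measure Ω') [IsProbabilityMeasure μ']
        (X' : ℕ → Ω' → Plane) (T' : ℕ → Ω' → ℝ),
        IsNetwork (lam * propMoment β S P μ₀) X' (fun _ _ => 1) (fun _ _ => 1) T'
          (F.map fun t => (1, 1, t)) μ' →
        EqualInLaw (markedPropagation K β X SX PX TX) μ
          (markedPropagation K β X' (fun _ _ => 1) (fun _ _ => 1) T') μ' ∧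
        ∀ W γ : ℝ≥0, γ ≤ 1 →
          EqualInLaw
            (countingProcess fun n ω => (sinr W γ K β X SX PX n ω, TX n ω)) μ
            (countingProcess fun n ω =>
              (sinr W γ K β X' (fun _ _ => 1) (fun _ _ => 1) n ω, T' n ω)) μ' ∧
          EqualInLaw
            (countingProcess fun n ω => (stinr W γ K β X SX PX n ω, TX n ω)) μ
            (countingProcess fun n ω =>
              (stinr W γ K β X' (fun _ _ => 1) (fun _ _ => 1) n ω, T' n ω)) μ' ∧
          ∀ n : ℕ,
            factorialMomentMeasure (sinr W γ K β X SX PX) n μ =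
              factorialMomentMeasure (sinr W γ K β X' (fun _ _ => 1) (fun _ _ => 1)) n μ' ∧
            factorialMomentMeasure (stinr W γ K β X SX PX) n μ =
              factorialMomentMeasure (stinr W γ K β X' (fun _ _ => 1) (fun _ _ => 1)) n μ') := by
  have hβ0 : 0 < β := by linarith
  have hPS : ∀ᵐ ω ∂μ₀, 0 < P ω * S ω := hpos.mono fun ω h => mul_pos h.2.1 h.1
  have hE := propMoment_pos hPS hmoment
  have hlam' : 0 ≤ lam * propMoment β S P μ₀ := by positivity
  have hQ : ∀ᵐ q ∂(μ₀.map fun ω => (S ω, P ω, T ω)), 0 < q.2.1 * q.1 := by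
    refine (ae_map_iff (hS.prodMk (hP.prodMk hT)).aemeasurable
      (measurableSet_lt measurable_const ?_)).2 hPS
    fun_prop
  have hF := isProbabilityMeasure_biasedThreshold hT hPS hmoment
  let F := biasedThreshold β S P T μ₀
  have hres := hnet.isPoissonProcess_rescaled (β := β) hQ
    (κ := (ENNReal.ofReal (propMoment β S P μ₀)).toNNReal • F) (by
      rw [map_withDensity_threshold hS hP hT,
        ← ofReal_propMoment_smul_biasedThreshold hPS hmoment]
      rfl)
  -- The total mass `𝐄[(PS)^(2/β)]` of the biased marks is moved to the plane factor, turning `λ`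
  -- into `λ*` and the mark factor into a probability.
  have hprod : (ENNReal.ofReal lam • (volume : Measure Plane)).prod
      ((ENNReal.ofReal (propMoment β S P μ₀)).toNNReal • F) =
      (ENNReal.ofReal (lam * propMoment β S P μ₀) • volume).prod F := by
    have h1 : (ENNReal.ofReal (propMoment β S P μ₀)).toNNReal • F =
        ENNReal.ofReal (propMoment β S P μ₀) • F := rfl
    rw [h1, Measure.prod_smul_right, Measure.prod_smul_left, Measure.prod_smul_left, smul_smul,
      mul_comm, ← ENNReal.ofReal_mul hlam.le]
  rw [hprod] at hres
  have hpp := hnet.isPoissonProcess_markedPropagation hK hβ0 hQ hres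
  have hw := hnet.measurable_loss_threshold K β
  have ho := ae_orderable_of_lossIntensity hlam' hK hβ0 hpp
  refine ⟨F, hF, fun t => ?_, ⟨(lossIntensity (lam * propMoment β S P μ₀) K β).prod F,
    fun s t hs => ?_, hpp, isIndependentlyMarkedPoisson_of_isPoissonProcess hw hpp ho⟩, ?_, ?_, ?_⟩
  · rw [measureReal_def, biasedThreshold_Iic hT hPS hmoment, ENNReal.toReal_ofReal]
    exact div_nonneg (propMomentUpTo_nonneg hPS t) hE.le
  · rw [Measure.prod_prod, lossIntensity_Iic hlam' hK hβ0 hs, biasedThreshold_Iic hT hPS hmoment,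
      ← ENNReal.ofReal_mul (by positivity)]
    congr 1
    field_simp
  · rw [propConstant]
    field_simp
  · have hZ : ∀ n, Measurable fun ω => ((PX n ω * SX n ω) ^ (1 / β))⁻¹ • X n ω := fun n => by
      have hm := hnet.marks.measurable_mark n
      have h1 : Measurable fun ω => ((PX n ω * SX n ω) ^ (1 / β))⁻¹ :=
        (((measurable_fst.comp (measurable_snd.comp hm)).mul
          (measurable_fst.comp hm)).pow_const (1 / β)).inv
      exact h1.smul (hnet.marks.measurable_point n)
    -- The equivalent network uses the rescaled stations of the given one, with its thresholds
    -- discarded and fresh independent ones of law `F` attached on a product space.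
    have hnet' : IsNetwork (lam * propMoment β S P μ₀)
        (fun n (p : Ω × (ℕ → ℝ)) => ((PX n p.1 * SX n p.1) ^ (1 / β))⁻¹ • X n p.1)
        (fun _ _ => 1) (fun _ _ => 1) (fun n p => p.2 n) (F.map fun t => (1, 1, t))
        (μ.prod (Measure.infinitePi fun _ => F)) := by
      have hmk : Measurable fun t : ℝ => ((1 : ℝ), (1 : ℝ), t) := by fun_prop
      refine ⟨?_, (isIndependentMarking_prod hZ).map_mark hmk⟩
      have h1 := hres.map measurable_fst
      rw [Measure.map_fst_prod, measure_univ, one_smul] at h1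
      simp_rw [map_countingProcess _ _ measurable_fst] at h1
      exact h1.comp measurePreserving_fst
    exact ⟨Ω × (ℕ → ℝ), inferInstance, μ.prod (Measure.infinitePi fun _ => F), _, _,
      inferInstance, hnet', hpp.identDistrib hnet'.isPoissonProcess_markedPropagation_one⟩
  · intro Ω' _ μ' _ X' T' hnet'
    have hpp' := hnet'.isPoissonProcess_markedPropagation_one (K := K) (β := β)
    have hid := hpp.identDistrib hpp'
    exact ⟨hid, fun W γ _ => sinr_stinr_of_identDistrib hw
      (hnet'.measurable_loss_threshold K β) ho
      (ae_orderable_of_lossIntensity hlam' hK hβ0 hpp') hid W γ⟩
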